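/- **Setting.** A user at the origin is served by a high-altitude platform (HAP) through a reconfigurable intelligent surface (RIS) with $L\ge 1$ reflecting elements, and possibly also by a direct link (which may be blocked, $u=0$). The combined channel response is $$A=\frac{\sum_{l=1}^{L} q_l\,g_l\,e^{j\theta_l}}{R_q^{\epsilon/2}R_g^{\varepsilon/2}}+\frac{u}{R_u^{\varrho/2}},\qquad \theta_l=\angle u-(\angle q_l+\angle g_l),$$ with path-loss exponents $\epsilon,\varepsilon,\varrho>0$, $R_q=\sqrt{\omega_q^2+(H_{\rm HAP}-H_{\rm RIS})^2}$, $R_g=\sqrt{\omega_g^2+H_{\rm RIS}^2}$, $R_u=\sqrt{\omega_u^2+H_{\rm HAP}^2}$ and heights $0<H_{\rm RIS}<H_{\rm HAP}$. The magnitudes $|q_l|,|g_l|,|u|$ and the horizontal distances $\omega_q,\omega_g,\omega_u$ are independent; $|q_l|,|g_l|$, and $|u|$ if the direct link is present, are $\kappa$–$\mu$ distributed with unit mean power, with parameters $(\kappa_q,\mu_q),(\kappa_g,\mu_g),(\kappa_u,\mu_u)$, $\kappa\ge 0$, $\mu>0$. The distances $\omega_q,\omega_u$ have density $2\lambda\pi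 w e^{-\lambda\pi w^2}$ on $w\ge 0$, where $\lambda>0$ is the HAP intensity, and $\omega_g$ has density $2\pi\mu_{\rm RIS}w\exp(-(\Upsilon w+p+2\pi\mu_{\rm RIS}U(w)))$ on $w\ge0$, where $\mu_{\rm RIS}>0$ is the RIS intensity, $\Upsilon=2\lambda_B(\ell+\ell')/\pi$, $p=\lambda_B\,\ell\,\ell'$, $U(w)=\frac{e^{-p}}{\Upsilon^2}[1-(\Upsilon w+1)e^{-\Upsilon w}]$, $\lambda_B>0$ is the building intensity and $\ell,\ell'>0$ the mean building length and width; with the remaining probability no RIS is visible ($\omega_g=\infty$) and the reflected path contributes $0$. Let $\rho_0=E_s/N_0>0$ be the transmit SNR. **Theorem.** $|A|$ is square integrable, and its mean and variance are both positive. With $$m_\kappa(\kappa,\mu)=\frac{\Gamma(\mu+\frac12)e^{-\kappa\mu}}{\Gamma(\mu)((1+\kappa)\mu)^{1/2}}\,{}_1F_1(\mu+\tfrac12;\mu;\kappa\mu),\quad M_{\eta,H}(t)=(\pi\lambda)^{\eta t/4}e^{\pi H^2\lambda}\,\Gamma(1-\tfrac{\eta t}{4},\pi\lambda H^2),$$ $$G(t)=2\pi\mu_{\rm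 RIS}e^{-p}\int_0^\infty (w^2+H_{\rm RIS}^2)^{-t\varepsilon/4}\,w\,e^{-(\Upsilon w+2\pi\mu_{\rm RIS}U(w))}\,dw,$$ and $H=H_{\rm HAP}-H_{\rm RIS}$, $d=1$ if the direct link is present and $d=0$ if it is blocked, $P_1=L\,m_\kappa(\kappa_q,\mu_q)\,m_\kappa(\kappa_g,\mu_g)\,M_{\epsilon,H}(1)\,G(1)$, $P_2=d\,M_{\varrho,H_{\rm HAP}}(1)\,m_\kappa(\kappa_u,\mu_u)$, they are $$\mathbb E|A|=P_1+P_2,$$ $$\operatorname{Var}|A|=\big[(L^2-L)m_\kappa(\kappa_q,\mu_q)^2m_\kappa(\kappa_g,\mu_g)^2+L\big]M_{\epsilon,H}(2)\,G(2)-P_1^2+d\,M_{\varrho,H_{\rm HAP}}(2)-P_2^2 .$$ Put $\alpha=(\mathbb E|A|)^2/\operatorname{Var}|A|$ and $\beta=\operatorname{Var}|A|/\mathbb E|A|$. Then the approximate density $$f_\rho(x)=\frac{1}{2\beta^\alpha\Gamma(\alpha)}\rho_0^{-\alpha/2}x^{(\alpha-2)/2}e^{-\sqrt{x/(\beta^2\rho_0)}},\qquad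 x>0,$$ of the end-to-end SNR $\rho=\rho_0|A|^2$ is a probability density for which $\log_2(1+x)$ is integrable, and, whenever $\alpha$ is not an integer, the ergodic capacity $\bar{\mathcal C}=\int_0^\infty\log_2(1+x)f_\rho(x)\,dx$ under this density equals, with $z=1/(\beta^2\rho_0)$, $$\begin{aligned}\bar{\mathcal C}=\frac1{\ln 2}\Big\{&\frac{\pi}{\alpha\Gamma(\alpha)}z^{\alpha/2}\csc\!\big(\tfrac{\pi\alpha}{2}\big)\,{}_1F_2\!\big(\tfrac\alpha2;\tfrac12,1+\tfrac\alpha2;-\tfrac z4\big)+\frac{\Gamma(\alpha-2)}{\Gamma(\alpha)}\,z\;{}_2F_3\!\big(1,1;2,\tfrac32-\tfrac\alpha2,2-\tfrac\alpha2;-\tfrac z4\big)\\&-\frac{1}{(1+\alpha)\Gamma(\alpha)}\Big[(2-\alpha-2\alpha^2+\alpha^3)\Gamma(\alpha-2)\big(\ln z-2\psi(\alpha)\big)\\&\qquad+\pi z^{(1+\alpha)/2}\,{}_1F_2\!\big(\tfrac12+\tfrac\alpha2;\tfrac32,\tfrac32+\tfrac\alpha2;-\tfrac z4\big)\sec\!\big(\tfrac{\pi\alpha}{2}\big)\Big]\Big\},\end{aligned}$$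 where $\psi$ is the digamma function, $\Gamma(\cdot,\cdot)$ the upper incomplete Gamma function and ${}_pF_q$ the generalized hypergeometric function. -/

import Mathlib

open MeasureTheory ProbabilityTheory
open scoped ENNReal

/-! ### Special functions -/

/-- The generalized hypergeometric function `pFq(a₁,…,a_p; b₁,…,b_q; z)`, not regularized:
`∑ₙ (a₁)ₙ ⋯ (a_p)ₙ / ((b₁)ₙ ⋯ (b_q)ₙ) · zⁿ / n!` with rising factorials `(a)ₙ`. -/
noncomputable def hypergeometricPFQ (a b : List ℝ) (z : ℝ) : ℝ :=
  ∑' n : ℕ, (a.map fun s => (ascPochhammer ℝ n).eval s).prod /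
    (b.map fun s => (ascPochhammer ℝ n).eval s).prod * (z ^ n / (n.factorial : ℝ))

/-- The upper incomplete Gamma function `Γ(s, x)`. -/
noncomputable def upperIncompleteGamma (s x : ℝ) : ℝ :=
  ∫ t in Set.Ioi x, t ^ (s - 1) * Real.exp (-t)

/-- The digamma function `ψ⁽⁰⁾` on the real line. -/
noncomputable def realDigamma (s : ℝ) : ℝ := (Complex.digamma (s : ℂ)).re

/-! ### κ–μ fading -/

/-- Density of the envelope of a κ–μ faded coefficient of unit mean power. The sum is the power
series of the modified Bessel function `I_{μ-1}`: for `κ > 0` the value at `r > 0` is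
`2 μ (1+κ)^((μ+1)/2) κ^(-(μ-1)/2) e^(-κμ) r^μ e^(-μ(1+κ)r²) I_{μ-1}(2 μ r √(κ(1+κ)))`,
and for `κ = 0` it is the Nakagami density (its limit as `κ → 0`). -/
noncomputable def kappaMuPDF (κ μ r : ℝ) : ℝ :=
  if 0 < r then
    2 * (μ * (1 + κ)) ^ μ * r ^ (2 * μ - 1) * Real.exp (-(κ * μ) - μ * (1 + κ) * r ^ 2) *
      ∑' k : ℕ, (κ * μ * (μ * (1 + κ)) * r ^ 2) ^ k / ((k.factorial : ℝ) * Real.Gamma (μ + k))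
  else 0

/-- The κ–μ distribution of unit mean power. -/
noncomputable def kappaMuLaw (κ μ : ℝ) : Measure ℝ :=
  volume.withDensity fun r => ENNReal.ofReal (kappaMuPDF κ μ r)

/-- The expression for the first moment of the κ–μ envelope of unit mean power. -/
noncomputable def kappaMuMean (κ μ : ℝ) : ℝ :=
  Real.Gamma (μ + 1 / 2) * Real.exp (-(κ * μ)) / (Real.Gamma μ * ((1 + κ) * μ) ^ (1 / 2 : ℝ)) *
    hypergeometricPFQ [μ + 1 / 2] [μ] (κ * μ)

/-! ### The network -/

/-- Parameters of the network: intensities of the HAPs, RISs and buildings, mean building length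
and width, heights of the HAPs and RISs, number of reflecting elements, path-loss exponents of the
HAP–RIS (`expQ`), RIS–user (`expG`) and HAP–user (`expU`) links, their κ–μ parameters, symbol
energy, noise power, and whether the direct HAP–user link is present (`direct = true`) or blocked
(`direct = false`). -/
structure HAPNetwork where
  lamHAP : ℝ
  muRIS : ℝ
  lamB : ℝ
  meanLength : ℝ
  meanWidth : ℝ
  heightHAP : ℝ
  heightRIS : ℝ
  numRE : ℕ
  expQ : ℝ
  expG : ℝ
  expU : ℝ
  kappaQ : ℝ
  muQ : ℝ
  kappaG : ℝ
  muG : ℝ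
  kappaU : ℝ
  muU : ℝ
  symbolEnergy : ℝ
  noisePower : ℝ
  direct : Bool
  lamHAP_pos : 0 < lamHAP
  muRIS_pos : 0 < muRIS
  lamB_pos : 0 < lamB
  meanLength_pos : 0 < meanLength
  meanWidth_pos : 0 < meanWidth
  heightRIS_pos : 0 < heightRIS
  heightRIS_lt : heightRIS < heightHAP
  numRE_pos : 0 < numRE
  expQ_pos : 0 < expQ
  expG_pos : 0 < expG
  expU_pos : 0 < expU
  kappaQ_nonneg : 0 ≤ kappaQ
  muQ_pos : 0 < muQ
  kappaG_nonneg : 0 ≤ kappaG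
  muG_pos : 0 < muG
  kappaU_nonneg : 0 ≤ kappaU
  muU_pos : 0 < muU
  symbolEnergy_pos : 0 < symbolEnergy
  noisePower_pos : 0 < noisePower

namespace HAPNetwork

variable (S : HAPNetwork)

/-- The transmit SNR `ρ₀ = E_s / N₀`. -/
noncomputable def rho0 : ℝ := S.symbolEnergy / S.noisePower

/-- `Υ = 2 λ_B (E[L] + E[W]) / π`. -/
noncomputable def upsilon : ℝ := 2 * S.lamB * (S.meanLength + S.meanWidth) / Real.pi

/-- `p = λ_B E[L] E[W]`. -/
noncomputable def blockP : ℝ := S.lamB * S.meanLength * S.meanWidth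

/-- `U(w) = e^(-p) / Υ² · (1 - (Υ w + 1) e^(-Υ w))`. -/
noncomputable def blockU (w : ℝ) : ℝ :=
  Real.exp (-S.blockP) / S.upsilon ^ 2 *
    (1 - (S.upsilon * w + 1) * Real.exp (-(S.upsilon * w)))

/-- Density of the horizontal distance to the nearest visible RIS. Its total mass is
`1 - exp (-2 π μ_RIS e^(-p) / Υ²)`: with the remaining probability no RIS is visible. -/
noncomputable def distRISPDF (w : ℝ) : ℝ :=
  if 0 ≤ w then
    2 * Real.pi * S.muRIS * w *
      Real.exp (-(S.upsilon * w + S.blockP + 2 * Real.pi * S.muRIS * S.blockU w))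
  else 0

/-- Law of the horizontal RIS–user distance, the value `∞` meaning that no RIS is visible. -/
noncomputable def distRISLaw : Measure ℝ≥0∞ :=
  (volume.withDensity fun w => ENNReal.ofReal (S.distRISPDF w)).map ENNReal.ofReal +
    ENNReal.ofReal
        (Real.exp (-(2 * Real.pi * S.muRIS * (Real.exp (-S.blockP) / S.upsilon ^ 2)))) •
      Measure.dirac ∞

/-- Density of the horizontal distance to the serving (nearest) HAP. -/
noncomputable def distHAPPDF (w : ℝ) : ℝ :=
  if 0 ≤ w then
    2 * S.lamHAP * Real.pi * w * Real.exp (-(S.lamHAP * Real.pi * w ^ 2))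
  else 0

/-- Law of the horizontal HAP–RIS and HAP–user distances. -/
noncomputable def distHAPLaw : Measure ℝ≥0∞ :=
  (volume.withDensity fun w => ENNReal.ofReal (S.distHAPPDF w)).map ENNReal.ofReal

/-- The expression for the `t`-th moment of `R^(-η/2)`, `R` the HAP–RIS or HAP–user distance
across the vertical distance `H`. -/
noncomputable def momentHAP (η H t : ℝ) : ℝ :=
  (Real.pi * S.lamHAP) ^ (η * t / 4) * Real.exp (Real.pi * H ^ 2 * S.lamHAP) *
    upperIncompleteGamma (1 - η * t / 4) (H ^ 2 * S.lamHAP * Real.pi)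

/-- The expression for the `t`-th moment of `R_g^(-ε/2)`, `R_g` the RIS–user distance. -/
noncomputable def momentRIS (t : ℝ) : ℝ :=
  2 * Real.pi * S.muRIS * Real.exp (-S.blockP) *
    ∫ w in Set.Ioi (0 : ℝ), (w ^ 2 + S.heightRIS ^ 2) ^ (-(t * S.expG / 4)) * w *
      Real.exp (-(S.upsilon * w + 2 * Real.pi * S.muRIS *
        (Real.exp (-S.blockP) / S.upsilon ^ 2 *
          (1 - (S.upsilon * w + 1) * Real.exp (-(S.upsilon * w))))))

/-- Contribution of the reflected path to the mean of the combined channel response. -/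
noncomputable def meanP1 : ℝ :=
  S.numRE * kappaMuMean S.kappaQ S.muQ * kappaMuMean S.kappaG S.muG *
    S.momentHAP S.expQ (S.heightHAP - S.heightRIS) 1 * S.momentRIS 1

/-- Contribution of the direct path to the mean of the combined channel response. -/
noncomputable def meanP2 : ℝ :=
  if S.direct then
    S.momentHAP S.expU S.heightHAP 1 * kappaMuMean S.kappaU S.muU
  else 0

/-- Expression for the mean of the combined channel response. -/
noncomputable def meanA : ℝ := S.meanP1 + S.meanP2

/-- Expression for the variance of the combined channel response. -/
noncomputable def varA : ℝ :=
  ((((S.numRE : ℝ) ^ 2 - S.numRE) *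
        (kappaMuMean S.kappaQ S.muQ ^ 2 * kappaMuMean S.kappaG S.muG ^ 2) + S.numRE) *
      S.momentHAP S.expQ (S.heightHAP - S.heightRIS) 2 * S.momentRIS 2 - S.meanP1 ^ 2) +
    ((if S.direct then S.momentHAP S.expU S.heightHAP 2 else 0) - S.meanP2 ^ 2)

end HAPNetwork

/-- `R^(-η/2)` for the diagonal distance `R = √(w² + H²)` with horizontal distance `w` and vertical
distance `H`; there is no gain at infinite distance. -/
noncomputable def pathGain (η H : ℝ) (w : ℝ≥0∞) : ℝ :=
  if w = ∞ then 0 else (Real.sqrt (w.toReal ^ 2 + H ^ 2)) ^ (-(η / 2))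

/-- Labels of the independent sources of randomness: the magnitudes of the fading coefficients
`q l`, `g l`, `u`, and the horizontal distances of the three links. -/
inductive ChannelSource (L : ℕ) : Type
  | q (l : Fin L)
  | g (l : Fin L)
  | u
  | distQ
  | distG
  | distU

/-- The random channel of the network `S` on the probability space `(Ω, P)`: complex fading
coefficients with κ–μ distributed magnitudes and arbitrary phases, and horizontal distances of the
HAP–RIS (`distQ`), RIS–user (`distG`) and HAP–user (`distU`) links. -/
structure HAPChannel (S : HAPNetwork) {Ω : Type*} [MeasurableSpace Ω] (P : Measure Ω) where
  q : Fin S.numRE → Ω → ℂ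
  g : Fin S.numRE → Ω → ℂ
  u : Ω → ℂ
  distQ : Ω → ℝ≥0∞
  distG : Ω → ℝ≥0∞
  distU : Ω → ℝ≥0∞
  measurable_q : ∀ l, Measurable (q l)
  measurable_g : ∀ l, Measurable (g l)
  measurable_u : Measurable u
  measurable_distQ : Measurable distQ
  measurable_distG : Measurable distG
  measurable_distU : Measurable distU
  law_q : ∀ l, HasLaw (fun ω => ‖q l ω‖) (kappaMuLaw S.kappaQ S.muQ) P
  law_g : ∀ l, HasLaw (fun ω => ‖g l ω‖) (kappaMuLaw S.kappaG S.muG) P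
  law_u : HasLaw (fun ω => ‖u ω‖)
    (if S.direct then kappaMuLaw S.kappaU S.muU else Measure.dirac 0) P
  law_distQ : HasLaw distQ S.distHAPLaw P
  law_distG : HasLaw distG S.distRISLaw P
  law_distU : HasLaw distU S.distHAPLaw P
  indep : iIndepFun (fun (s : ChannelSource S.numRE) (ω : Ω) =>
    (match s with
      | .q l => ‖q l ω‖ₑ
      | .g l => ‖g l ω‖ₑ
      | .u => ‖u ω‖ₑ
      | .distQ => distQ ω
      | .distG => distG ω
      | .distU => distU ω : ℝ≥0∞)) P

namespace HAPChannel

variable {S : HAPNetwork} {Ω : Type*} [MeasurableSpace Ω] {P : Measure Ω} (C : HAPChannel S P)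

/-- The response `ζ_l = exp(j θ_l)` of the `l`-th reflecting element, with the phase shift
`θ_l = ∠u - (∠q_l + ∠g_l)`. -/
noncomputable def zeta (l : Fin S.numRE) (ω : Ω) : ℂ :=
  Complex.exp (Complex.I *
    ((Complex.arg (C.u ω) - (Complex.arg (C.q l ω) + Complex.arg (C.g l ω)) : ℝ) : ℂ))

/-- The combined channel response
`A = (∑_l q_l g_l ζ_l) / (R_q^(ε/2) R_g^(ε'/2)) + u / R_u^(ϱ/2)`. -/
noncomputable def response (ω : Ω) : ℂ :=
  (∑ l, C.q l ω * C.g l ω * C.zeta l ω) *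
      ((pathGain S.expQ (S.heightHAP - S.heightRIS) (C.distQ ω) *
        pathGain S.expG S.heightRIS (C.distG ω) : ℝ) : ℂ) +
    C.u ω * ((pathGain S.expU S.heightHAP (C.distU ω) : ℝ) : ℂ)

/-- `α = (E|A|)² / Var|A|`. -/
noncomputable def alpha : ℝ := (∫ ω, ‖C.response ω‖ ∂P) ^ 2 / Var[fun ω => ‖C.response ω‖; P]

/-- `β = Var|A| / E|A|`. -/
noncomputable def beta : ℝ := Var[fun ω => ‖C.response ω‖; P] / ∫ ω, ‖C.response ω‖ ∂P

end HAPChannel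

/-! ### The approximate SNR and its ergodic capacity -/

/-- The approximate density of the end-to-end SNR. -/
noncomputable def snrPDF (α β ρ₀ x : ℝ) : ℝ :=
  if 0 < x then
    1 / (2 * β ^ α * Real.Gamma α) * ρ₀ ^ (-(α / 2)) * x ^ ((α - 2) / 2) *
      Real.exp (-Real.sqrt (x / (β ^ 2 * ρ₀)))
  else 0

/-- The approximate law of the end-to-end SNR. -/
noncomputable def snrLaw (α β ρ₀ : ℝ) : Measure ℝ :=
  volume.withDensity fun x => ENNReal.ofReal (snrPDF α β ρ₀ x)

/-- The ergodic capacity `E[log₂(1 + ρ)]` for `ρ` with the approximate SNR law. -/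
noncomputable def ergodicCapacity (α β ρ₀ : ℝ) : ℝ :=
  ∫ x, Real.logb 2 (1 + x) ∂(snrLaw α β ρ₀)

/-- The closed form of the ergodic capacity; `csc` and `sec` are written as `1 / sin` and
`1 / cos`, and `log` is the natural logarithm. -/
noncomputable def capacityClosedForm (α β ρ₀ : ℝ) : ℝ :=
  1 / Real.log 2 *
    (Real.pi / (α * Real.Gamma α) * (1 / (β ^ 2 * ρ₀)) ^ (α / 2) *
        (1 / Real.sin (Real.pi * α / 2)) *
        hypergeometricPFQ [α / 2] [1 / 2, 1 + α / 2] (-(1 / (4 * β ^ 2 * ρ₀))) +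
      Real.Gamma (α - 2) / Real.Gamma α * (1 / (β ^ 2 * ρ₀)) *
        hypergeometricPFQ [1, 1] [2, 3 / 2 - α / 2, 2 - α / 2] (-(1 / (4 * β ^ 2 * ρ₀))) -
      1 / (1 + α) * (1 / Real.Gamma α) *
        ((2 - α - 2 * α ^ 2 + α ^ 3) * Real.Gamma (α - 2) *
            (Real.log (1 / (β ^ 2 * ρ₀)) - 2 * realDigamma α) +
          Real.pi * (1 / (β ^ 2 * ρ₀)) ^ ((1 + α) / 2) *
            hypergeometricPFQ [1 / 2 + α / 2] [3 / 2, 3 / 2 + α / 2]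
              (-(1 / (4 * β ^ 2 * ρ₀))) *
            (1 / Real.cos (Real.pi * α / 2))))

open Filter Topology Set

/-! ### Rapidly decaying coefficient sequences -/

/-! The theorem joins the exact first two moments of |A| with the exact integral of log(1 + x)
against the density of a scaled squared Gamma variable.

Moments. The phase shifts give every reflected term the phase of u, so |A| is the sum of the
reflected and direct magnitudes (`norm_response`), and these are independent. The κ–μ law is a
Poisson mixture of Nakagami laws, so its moments are series that can be summed; the moments of the
path gains come from a change of variables; products factor by independence. The variance is
positive because the reflected path has positive mean and yet vanishes with positive probability,
when no RIS is visible.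

Capacity. With t = √z, the substitution x = (y/t)² turns the SNR density into y^(α-1) e^(-y) / Γ(α),
and the task becomes J(t) = ∫ log(t² + y²) y^(α-1) e^(-y) dy. Its derivative is 2 t^(α-1) F_α(t),
where F_s(t) = ∫ y^(s-1) e^(-ty) / (1 + y²) dy. One has F_s' = -F_(s+1) and F_(s+2) + F_s = Γ(s)
t^(-s), and an explicit series obeys the same two relations. For 0 < s < 1 the errors at s and s + 1
rotate into each other, so the sum of their squares is constant; it tends to 0 at t = 0, hence
vanishes. The recurrence then reaches every non-integer s > 0 (`laplaceCauchy_eq_series`).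
Integrating from 0, where J tends to 2 Γ(α) ψ(α), expands J (`logGammaIntegral_eq_series`), and the
three power series that appear are the three hypergeometric functions. At integer α the sine, the
cosine or the Gamma coefficients degenerate. -/

lemma summable_mul_pow_of_ratio_tendsto_zero {c r : ℕ → ℝ} (h : ∀ n, c (n + 1) = c n * r n)
    (hr : Tendsto r atTop (𝓝 0)) (x : ℝ) : Summable fun n => c n * x ^ n := by
  have h2 : ∀ᶠ n in atTop, |r n * x| < 1 / 2 := by
    have := (hr.mul_const x).abs
    simp only [zero_mul, abs_zero] at this
    exact this.eventually_lt_const (by norm_num)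
  refine summable_of_ratio_norm_eventually_le (r := 1 / 2) (by norm_num) ?_
  filter_upwards [h2] with n hn
  rw [h, pow_succ, show c n * r n * (x ^ n * x) = (r n * x) * (c n * x ^ n) by ring, norm_mul]
  exact mul_le_mul_of_nonneg_right hn.le (norm_nonneg _)

lemma summable_abs_mul_pow {c : ℕ → ℝ} (hc : ∀ x : ℝ, Summable fun n => c n * x ^ n) {x : ℝ}
    (hx : 0 ≤ x) : Summable fun n => |c n| * x ^ n := by
  simpa [abs_mul, abs_of_nonneg (pow_nonneg hx _)] using (hc x).abs

lemma rpow_two_mul_nat_add {y : ℝ} (hy : 0 < y) (n : ℕ) (p : ℝ) :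
    y ^ (2 * (n : ℝ) + p) = (y ^ 2) ^ n * y ^ p := by
  rw [Real.rpow_add hy, ← pow_mul]
  congr 1
  rw [← Real.rpow_natCast]
  push_cast
  rfl

lemma summable_mul_rpow {c : ℕ → ℝ} (hc : ∀ x : ℝ, Summable fun n => c n * x ^ n) (p : ℝ) {t : ℝ}
    (ht : 0 < t) : Summable fun n : ℕ => c n * t ^ (2 * (n : ℝ) + p) := by
  simp only [rpow_two_mul_nat_add ht, ← mul_assoc]
  exact (hc _).mul_right _

/-- Adding both endpoint values covers the increasing and the decreasing case, so later bounds need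
not know the sign of the exponent. -/
lemma rpow_le_add_rpow {a b y : ℝ} (ha : 0 < a) (hy : y ∈ Ioo a b) (p : ℝ) :
    y ^ p ≤ a ^ p + b ^ p := by
  have hy0 : 0 < y := ha.trans hy.1
  have hb0 : 0 < b := hy0.trans hy.2
  rcases le_total 0 p with h | h
  · have := Real.rpow_le_rpow hy0.le hy.2.le h
    have h2 : 0 ≤ a ^ p := Real.rpow_nonneg ha.le _
    linarith
  · have := Real.rpow_le_rpow_of_nonpos ha hy.1.le h
    have h2 : 0 ≤ b ^ p := Real.rpow_nonneg hb0.le _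
    linarith

/-- The linear factor produced by differentiation is absorbed into a geometric one, which only
dilates the argument of an everywhere convergent series. -/
lemma abs_two_mul_nat_add_le (n : ℕ) (p : ℝ) : |2 * (n : ℝ) + p| ≤ 2 ^ n * (2 + |p|) := by
  have h3 : (n : ℝ) ≤ 2 ^ n := by exact_mod_cast (Nat.lt_two_pow_self (n := n)).le
  have h4 : (1 : ℝ) ≤ 2 ^ n := one_le_pow₀ (by norm_num)
  calc |2 * (n : ℝ) + p| ≤ 2 * n + |p| := by
        refine (abs_add_le _ _).trans ?_
        rw [abs_of_nonneg (by positivity : (0 : ℝ) ≤ 2 * n)]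
    _ ≤ _ := by nlinarith [abs_nonneg p]

lemma hasDerivAt_tsum_mul_rpow {c : ℕ → ℝ} (hc : ∀ x : ℝ, Summable fun n => c n * x ^ n) (p : ℝ)
    {t : ℝ} (ht : 0 < t) :
    HasDerivAt (fun t : ℝ => ∑' n : ℕ, c n * t ^ (2 * (n : ℝ) + p))
      (∑' n : ℕ, c n * ((2 * (n : ℝ) + p) * t ^ (2 * (n : ℝ) + p - 1))) t := by
  have hpos : ∀ y ∈ Ioo (t / 2) (2 * t), 0 < y := fun y hy => by linarith [hy.1]
  obtain ⟨M, hM⟩ : ∃ M : ℝ, ∀ y ∈ Ioo (t / 2) (2 * t), y ^ (p - 1) ≤ M :=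
    ⟨_, fun y hy => rpow_le_add_rpow (half_pos ht) hy (p - 1)⟩
  have hmem : t ∈ Ioo (t / 2) (2 * t) := ⟨by linarith, by linarith⟩
  -- In 8t² = 2 · 4t², the factor 4t² bounds y² on the interval and the 2 comes from
  -- `abs_two_mul_nat_add_le`.
  have hu : Summable fun n : ℕ => |c n| * (8 * t ^ 2) ^ n * ((2 + |p|) * M) :=
    (summable_abs_mul_pow hc (by positivity)).mul_right _
  refine hasDerivAt_tsum_of_isPreconnected (g := fun (n : ℕ) (y : ℝ) => c n * y ^ (2 * (n : ℝ) + p))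
    (g' := fun (n : ℕ) (y : ℝ) => c n * ((2 * (n : ℝ) + p) * y ^ (2 * (n : ℝ) + p - 1)))
    hu (isOpen_Ioo (a := t / 2) (b := 2 * t)) isPreconnected_Ioo (fun n y hy => ?_)
    (fun n y hy => ?_) hmem (summable_mul_rpow hc p ht) hmem
  · exact (Real.hasDerivAt_rpow_const (Or.inl (hpos y hy).ne')).const_mul _
  · have hy0 := hpos y hy
    have h5 : (y ^ 2) ^ n ≤ (4 * t ^ 2) ^ n := by
      refine pow_le_pow_left₀ (sq_nonneg _) ?_ n
      nlinarith [hy.2]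
    have h6 : 0 ≤ (y ^ 2) ^ n := pow_nonneg (sq_nonneg _) _
    have h7 : 0 ≤ y ^ (p - 1) := Real.rpow_nonneg hy0.le _
    rw [add_sub_assoc, rpow_two_mul_nat_add hy0, norm_mul, norm_mul, norm_mul, Real.norm_eq_abs,
      Real.norm_eq_abs, Real.norm_of_nonneg h6, Real.norm_of_nonneg h7, mul_assoc]
    refine mul_le_mul_of_nonneg_left ?_ (abs_nonneg _)
    calc |2 * (n : ℝ) + p| * ((y ^ 2) ^ n * y ^ (p - 1))
        ≤ (2 ^ n * (2 + |p|)) * ((4 * t ^ 2) ^ n * M) :=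
          mul_le_mul (abs_two_mul_nat_add_le n p) (mul_le_mul h5 (hM y hy) h7 (h6.trans h5))
            (mul_nonneg h6 h7) ((abs_nonneg _).trans (abs_two_mul_nat_add_le n p))
      _ = (2 * (4 * t ^ 2)) ^ n * ((2 + |p|) * M) := by rw [mul_pow 2 (4 * t ^ 2)]; ring
      _ = (8 * t ^ 2) ^ n * ((2 + |p|) * M) := by rw [show 2 * (4 * t ^ 2) = 8 * t ^ 2 by ring]

/-- For t < 1 each term is at most |c n| t^p, because (t²)^n ≤ 1. -/
lemma tendsto_tsum_mul_rpow {c : ℕ → ℝ} (hc : ∀ x : ℝ, Summable fun n => c n * x ^ n) {p : ℝ}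
    (hp : 0 < p) :
    Tendsto (fun t : ℝ => ∑' n : ℕ, c n * t ^ (2 * (n : ℝ) + p)) (𝓝[>] 0) (𝓝 0) := by
  have hs : Summable fun n => |c n| := by simpa using summable_abs_mul_pow hc zero_le_one
  have h1 : Tendsto (fun t : ℝ => (∑' n, |c n|) * t ^ p) (𝓝[>] 0) (𝓝 0) := by
    have : Tendsto (fun t : ℝ => t ^ p) (𝓝[>] 0) (𝓝 (0 ^ p)) :=
      ((Real.continuousAt_rpow_const 0 p (Or.inr hp.le)).tendsto).mono_left nhdsWithin_le_nhds
    rw [Real.zero_rpow hp.ne'] at this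
    simpa using this.const_mul (∑' n, |c n|)
  refine squeeze_zero_norm' ?_ h1
  filter_upwards [Ioo_mem_nhdsGT (zero_lt_one' ℝ)] with t ht
  have h2 : ∀ n : ℕ, ‖c n * t ^ (2 * (n : ℝ) + p)‖ ≤ |c n| * t ^ p := fun n => by
    rw [rpow_two_mul_nat_add ht.1, norm_mul, Real.norm_eq_abs,
      Real.norm_of_nonneg (by have := ht.1; positivity)]
    refine mul_le_mul_of_nonneg_left ?_ (abs_nonneg _)
    refine mul_le_of_le_one_left (Real.rpow_nonneg ht.1.le _) (pow_le_one₀ (sq_nonneg _) ?_)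
    nlinarith [ht.1, ht.2]
  calc _ ≤ ∑' n, |c n| * t ^ p := tsum_of_norm_bounded (hs.mul_right _).hasSum h2
    _ = _ := tsum_mul_right

/-- Uniqueness principle for both differential equations below; the initial condition is a right
limit, so nothing is required of the value at 0. -/
lemma eq_zero_of_hasDerivAt_zero {f : ℝ → ℝ} (hf : ∀ t, 0 < t → HasDerivAt f 0 t)
    (h0 : Tendsto f (𝓝[>] 0) (𝓝 0)) {t : ℝ} (ht : 0 < t) : f t = 0 := by
  have hc : ∀ s, 0 < s → f s = f t := fun s hs =>
    (convex_Ioi (0 : ℝ)).is_const_of_fderivWithin_eq_zero (𝕜 := ℝ)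
      (fun x hx => (hf x hx).differentiableAt.differentiableWithinAt)
      (fun x hx => by
        rw [fderivWithin_of_isOpen isOpen_Ioi hx]
        ext
        simp [(hf x hx).deriv]) hs ht
  have h1 : Tendsto f (𝓝[>] 0) (𝓝 (f t)) := by
    refine tendsto_const_nhds.congr' ?_
    filter_upwards [self_mem_nhdsWithin] with s hs using (hc s hs).symm
  exact tendsto_nhds_unique h1 h0

/-! ### Gamma values along an arithmetic progression of negative step -/

lemma Gamma_sub_two {s : ℝ} (h1 : s ≠ 1) (h2 : s ≠ 2) :
    Real.Gamma s = (s - 1) * (s - 2) * Real.Gamma (s - 2) := by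
  have a := Real.Gamma_add_one (sub_ne_zero.2 h1)
  have b := Real.Gamma_add_one (sub_ne_zero.2 h2)
  rw [sub_add_cancel] at a
  rw [show s - 2 + 1 = s - 1 by ring] at b
  rw [a, b]
  ring

/-- The coefficients of the expansion of `∫ y^(s-1) e^(-ty) / (1+y²) dy` in powers `t^(2n+2-s)`. -/
noncomputable def gammaCoeff (s : ℝ) (n : ℕ) : ℝ := (-1) ^ n * Real.Gamma (s - 2 * n - 2)

lemma tendsto_inv_mul_linear_zero (a b : ℝ) :
    Tendsto (fun n : ℕ => ((2 * (n : ℝ) + a) * (2 * n + b))⁻¹) atTop (𝓝 0) := by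
  have h : ∀ a : ℝ, Tendsto (fun n : ℕ => 2 * (n : ℝ) + a) atTop atTop := fun a =>
    tendsto_atTop_add_const_right _ _
      (tendsto_natCast_atTop_atTop.const_mul_atTop (by norm_num))
  exact ((h a).atTop_mul_atTop₀ (h b)).inv_tendsto_atTop

/-- Descending by two in the functional equation divides Γ by a quadratic in n. Non-integrality of s
keeps every argument away from the poles. -/
lemma summable_gammaCoeff {s : ℝ} (hs : ∀ n : ℤ, s ≠ n) (x : ℝ) :
    Summable fun n => gammaCoeff s n * x ^ n := by
  refine summable_mul_pow_of_ratio_tendsto_zero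
    (r := fun n : ℕ => -((2 * (n : ℝ) + (3 - s)) * (2 * n + (4 - s)))⁻¹) ?_
    (by simpa using (tendsto_inv_mul_linear_zero (3 - s) (4 - s)).neg) x
  intro n
  have h1 : s - 2 * n - 2 ≠ 1 := fun h => hs (2 * n + 3) (by push_cast; linarith)
  have h2 : s - 2 * n - 2 ≠ 2 := fun h => hs (2 * n + 4) (by push_cast; linarith)
  have h3 : (2 * (n : ℝ) + (3 - s)) ≠ 0 := fun h => h1 (by linarith)
  have h4 : (2 * (n : ℝ) + (4 - s)) ≠ 0 := fun h => h2 (by linarith)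
  unfold gammaCoeff
  rw [Gamma_sub_two h1 h2, pow_succ, show s - 2 * n - 2 - 2 = s - 2 * ((n : ℝ) + 1) - 2 by ring]
  push_cast
  generalize Real.Gamma (s - 2 * ((n : ℝ) + 1) - 2) = G
  field_simp
  ring

/-- The part of the expansion of `∫ y^(s-1) e^(-ty) / (1+y²) dy` in powers `t^(2n+2-s)`. -/
noncomputable def gammaSeries (s t : ℝ) : ℝ := ∑' n : ℕ, gammaCoeff s n * t ^ (2 * (n : ℝ) + (2 - s))

/-- The exponent brought down is -(s - 2n - 2), which raises the argument of Γ by one. -/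
lemma hasDerivAt_gammaSeries {s : ℝ} (hs : ∀ n : ℤ, s ≠ n) {t : ℝ} (ht : 0 < t) :
    HasDerivAt (gammaSeries s) (-gammaSeries (s + 1) t) t := by
  refine (hasDerivAt_tsum_mul_rpow (summable_gammaCoeff hs) (2 - s) ht).congr_deriv ?_
  rw [gammaSeries, ← tsum_neg]
  refine tsum_congr fun n => ?_
  have h : s - 2 * n - 2 ≠ 0 := fun h => hs (2 * n + 2) (by push_cast; linarith)
  have := Real.Gamma_add_one h
  rw [gammaCoeff, gammaCoeff, show s + 1 - 2 * (n : ℝ) - 2 = s - 2 * n - 2 + 1 by ring, this,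
    show 2 * (n : ℝ) + (2 - s) - 1 = 2 * n + (2 - (s + 1)) by ring]
  ring

/-- Raising s by two shifts the index by one and exposes the leading term Γ(s) t^(-s); the sign
comes from (-1)^n. -/
lemma gammaSeries_add_two {s : ℝ} (hs : ∀ n : ℤ, s ≠ n) {t : ℝ} (ht : 0 < t) :
    gammaSeries (s + 2) t = Real.Gamma s * t ^ (-s) - gammaSeries s t := by
  have hs' : ∀ n : ℤ, s + 2 ≠ n := fun n h => hs (n - 2) (by push_cast; linarith)
  rw [gammaSeries, (summable_mul_rpow (summable_gammaCoeff hs') _ ht).tsum_eq_zero_add,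
    sub_eq_add_neg (Real.Gamma s * _), gammaSeries, ← tsum_neg]
  congr 1
  · simp [gammaCoeff]
  · refine tsum_congr fun n => ?_
    rw [gammaCoeff, gammaCoeff, pow_succ]
    push_cast
    rw [show s + 2 - 2 * ((n : ℝ) + 1) - 2 = s - 2 * n - 2 by ring,
      show 2 * ((n : ℝ) + 1) + (2 - (s + 2)) = 2 * n + (2 - s) by ring]
    ring

/-! ### The Laplace transform of `y^(s-1) / (1+y²)` -/

lemma integrableOn_rpow_mul_exp_neg {s t : ℝ} (hs : 0 < s) (ht : 0 < t) :
    IntegrableOn (fun y : ℝ => y ^ (s - 1) * Real.exp (-(t * y))) (Ioi 0) := by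
  simpa using integrableOn_rpow_mul_exp_neg_mul_rpow (s := s - 1) (p := 1) (b := t) (by linarith)
    one_pos ht

/-- Since 1/(1 + y²) = ∫ e^(-v(1+y²)) dv, integrating over y first leaves a Gamma integral in v. The
value is Γ(s/2) Γ(1 - s/2) / 2, and the reflection formula produces the sine; 0 < s < 2 makes both
Gamma integrals converge. -/
lemma integrable_prod_rpow_mul_exp {s : ℝ} (h0 : 0 < s) (h2 : s < 2) :
    Integrable (Function.uncurry fun y v : ℝ => y ^ (s - 1) * Real.exp (-(v * (1 + y ^ 2))))
      ((volume.restrict (Ioi 0)).prod (volume.restrict (Ioi 0))) ∧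
    ∫ v in Ioi (0 : ℝ), ∫ y in Ioi (0 : ℝ), y ^ (s - 1) * Real.exp (-(v * (1 + y ^ 2))) =
      Real.pi / (2 * Real.sin (Real.pi * s / 2)) := by
  have hsplit : ∀ v y : ℝ, y ^ (s - 1) * Real.exp (-(v * (1 + y ^ 2))) =
      Real.exp (-v) * (y ^ (s - 1) * Real.exp (-v * y ^ (2 : ℝ))) := fun v y => by
    rw [mul_left_comm, ← Real.exp_add, Real.rpow_two]
    ring_nf
  have hval : ∀ v ∈ Ioi (0 : ℝ),
      ∫ y in Ioi (0 : ℝ), y ^ (s - 1) * Real.exp (-(v * (1 + y ^ 2))) =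
        1 / 2 * Real.Gamma (s / 2) * (v ^ ((1 - s / 2) - 1) * Real.exp (-(1 * v))) := by
    intro v hv
    simp_rw [hsplit]
    rw [integral_const_mul, integral_rpow_mul_exp_neg_mul_rpow two_pos (by linarith) hv]
    rw [show -(s - 1 + 1) / 2 = 1 - s / 2 - 1 by ring, show (s - 1 + 1) / 2 = s / 2 by ring]
    ring_nf
  constructor
  · have hm : AEStronglyMeasurable
        (Function.uncurry fun y v : ℝ => y ^ (s - 1) * Real.exp (-(v * (1 + y ^ 2))))
        ((volume.restrict (Ioi 0)).prod (volume.restrict (Ioi 0))) :=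
      Measurable.aestronglyMeasurable (by unfold Function.uncurry; fun_prop)
    rw [integrable_prod_iff' hm]
    constructor
    · filter_upwards [ae_restrict_mem measurableSet_Ioi] with v hv
      simp only [Function.uncurry, hsplit]
      exact (integrableOn_rpow_mul_exp_neg_mul_rpow (by linarith) two_pos hv).const_mul _
    · refine Integrable.congr ((integrableOn_rpow_mul_exp_neg (s := 1 - s / 2) (t := 1)
        (by linarith) one_pos).const_mul (1 / 2 * Real.Gamma (s / 2))) ?_
      filter_upwards [ae_restrict_mem measurableSet_Ioi] with v hv
      rw [← hval v hv]
      refine setIntegral_congr_fun measurableSet_Ioi fun y hy => ?_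
      simp only [Function.uncurry]
      rw [Real.norm_of_nonneg]
      have : 0 < y := hy
      positivity
  · rw [setIntegral_congr_fun measurableSet_Ioi hval, integral_const_mul,
      Real.integral_rpow_mul_exp_neg_mul_Ioi (by linarith) one_pos]
    have := Real.Gamma_mul_Gamma_one_sub (s / 2)
    rw [div_one, Real.one_rpow, one_mul, mul_assoc, this, mul_div_assoc Real.pi s 2]
    ring

lemma integral_Ioi_exp_neg_mul {b : ℝ} (hb : 0 < b) :
    ∫ v in Ioi (0 : ℝ), Real.exp (-(v * b)) = 1 / b := by
  have := Real.integral_rpow_mul_exp_neg_mul_Ioi one_pos hb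
  simpa [mul_comm] using this

lemma integral_rpow_mul_exp_eq_div (s y : ℝ) :
    ∫ v in Ioi (0 : ℝ), y ^ (s - 1) * Real.exp (-(v * (1 + y ^ 2))) = y ^ (s - 1) / (1 + y ^ 2) := by
  rw [integral_const_mul, integral_Ioi_exp_neg_mul (by positivity)]
  ring

lemma integrableOn_rpow_div_one_add_sq {s : ℝ} (h0 : 0 < s) (h2 : s < 2) :
    IntegrableOn (fun y : ℝ => y ^ (s - 1) / (1 + y ^ 2)) (Ioi 0) := by
  have := (integrable_prod_rpow_mul_exp h0 h2).1.integral_prod_left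
  simp only [Function.uncurry, integral_rpow_mul_exp_eq_div] at this
  exact this

lemma integral_rpow_div_one_add_sq {s : ℝ} (h0 : 0 < s) (h2 : s < 2) :
    ∫ y in Ioi (0 : ℝ), y ^ (s - 1) / (1 + y ^ 2) =
      Real.pi / (2 * Real.sin (Real.pi * s / 2)) := by
  rw [← (integrable_prod_rpow_mul_exp h0 h2).2,
    ← integral_integral_swap (integrable_prod_rpow_mul_exp h0 h2).1]
  simp only [integral_rpow_mul_exp_eq_div]

/-- The Laplace transform of `y^(s-1) / (1+y²)`. -/
noncomputable def laplaceCauchy (s t : ℝ) : ℝ :=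
  ∫ y in Ioi (0 : ℝ), y ^ (s - 1) * Real.exp (-(t * y)) / (1 + y ^ 2)

lemma integrableOn_laplaceCauchy {s t : ℝ} (hs : 0 < s) (ht : 0 < t) :
    IntegrableOn (fun y : ℝ => y ^ (s - 1) * Real.exp (-(t * y)) / (1 + y ^ 2)) (Ioi 0) := by
  refine (integrableOn_rpow_mul_exp_neg hs ht).mono'
    (Measurable.aestronglyMeasurable (by fun_prop)) ?_
  filter_upwards [ae_restrict_mem measurableSet_Ioi] with y hy
  have hy0 : 0 < y := hy
  rw [Real.norm_of_nonneg (by positivity)]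
  exact div_le_self (by positivity) (by nlinarith)

lemma hasDerivAt_laplaceCauchy {s t : ℝ} (hs : 0 < s) (ht : 0 < t) :
    HasDerivAt (laplaceCauchy s) (-laplaceCauchy (s + 1) t) t := by
  have hmem : Ioi (t / 2) ∈ 𝓝 t := Ioi_mem_nhds (by linarith)
  have key := (hasDerivAt_integral_of_dominated_loc_of_deriv_le
    (μ := volume.restrict (Ioi (0 : ℝ)))
    (F := fun t y : ℝ => y ^ (s - 1) * Real.exp (-(t * y)) / (1 + y ^ 2))
    (F' := fun t y : ℝ => -(y ^ (s + 1 - 1) * Real.exp (-(t * y)) / (1 + y ^ 2)))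
    -- On x > t/2 the exponential is at most e^(-ty/2), and the factor 1/(1 + y²) is at most 1.
    (bound := fun y : ℝ => y ^ (s + 1 - 1) * Real.exp (-(t / 2 * y))) (x₀ := t) hmem
    (Eventually.of_forall fun x => Measurable.aestronglyMeasurable (by fun_prop))
    (integrableOn_laplaceCauchy hs ht) (Measurable.aestronglyMeasurable (by fun_prop)) ?_
    (integrableOn_rpow_mul_exp_neg (by linarith) (by linarith)) ?_).2
  · rw [integral_neg] at key
    exact key
  · filter_upwards [ae_restrict_mem measurableSet_Ioi] with y hy x hx
    have hy0 : 0 < y := hy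
    have hx0 : t / 2 < x := hx
    rw [norm_neg, Real.norm_of_nonneg (by positivity)]
    refine (div_le_self (by positivity) (by nlinarith)).trans ?_
    gcongr
  · filter_upwards [ae_restrict_mem measurableSet_Ioi] with y hy x hx
    have hy0 : 0 < y := hy
    have h1 : HasDerivAt (fun x : ℝ => Real.exp (-(x * y))) (Real.exp (-(x * y)) * -y) x := by
      simpa using (((hasDerivAt_id x).mul_const y).neg).exp
    refine ((h1.const_mul (y ^ (s - 1))).div_const (1 + y ^ 2)).congr_deriv ?_
    rw [show s + 1 - 1 = (s - 1) + 1 by ring, Real.rpow_add_one hy0.ne']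
    ring

/-- This is y²/(1 + y²) = 1 - 1/(1 + y²) under the integral. With the derivative rule it says f'' +
f = Γ(s) t^(-s). -/
lemma laplaceCauchy_add_two {s t : ℝ} (hs : 0 < s) (ht : 0 < t) :
    laplaceCauchy (s + 2) t = Real.Gamma s * t ^ (-s) - laplaceCauchy s t := by
  have h1 : Real.Gamma s * t ^ (-s) = ∫ y in Ioi (0 : ℝ), y ^ (s - 1) * Real.exp (-(t * y)) := by
    rw [Real.integral_rpow_mul_exp_neg_mul_Ioi hs ht, one_div, Real.inv_rpow ht.le,
      Real.rpow_neg ht.le, mul_comm]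
  rw [h1, laplaceCauchy, laplaceCauchy, ← integral_sub (integrableOn_rpow_mul_exp_neg hs ht)
    (integrableOn_laplaceCauchy hs ht)]
  refine setIntegral_congr_fun measurableSet_Ioi fun y hy => ?_
  have hy0 : 0 < y := hy
  rw [show s + 2 - 1 = (s - 1) + 2 by ring, Real.rpow_add hy0, Real.rpow_two]
  field_simp
  ring

/-- For s < 2 the integrand at t = 0 is itself integrable and dominates. -/
lemma tendsto_laplaceCauchy {s : ℝ} (h0 : 0 < s) (h2 : s < 2) :
    Tendsto (laplaceCauchy s) (𝓝[>] 0) (𝓝 (Real.pi / (2 * Real.sin (Real.pi * s / 2)))) := by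
  rw [← integral_rpow_div_one_add_sq h0 h2]
  refine tendsto_integral_filter_of_dominated_convergence (fun y : ℝ => y ^ (s - 1) / (1 + y ^ 2))
    (Eventually.of_forall fun x => Measurable.aestronglyMeasurable (by fun_prop)) ?_
    (integrableOn_rpow_div_one_add_sq h0 h2) ?_
  · filter_upwards [self_mem_nhdsWithin] with t ht
    filter_upwards [ae_restrict_mem measurableSet_Ioi] with y hy
    have hy0 : 0 < y := hy
    have ht0 : 0 < t := ht
    rw [Real.norm_of_nonneg (by positivity)]
    gcongr
    exact mul_le_of_le_one_right (by positivity) (Real.exp_le_one_iff.2 (by nlinarith))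
  · refine ae_of_all _ fun y => ?_
    have : ContinuousAt (fun t : ℝ => y ^ (s - 1) * Real.exp (-(t * y)) / (1 + y ^ 2)) 0 := by
      fun_prop
    have h := this.tendsto.mono_left (nhdsWithin_le_nhds (s := Ioi 0))
    simpa using h

/-- The expansion of `laplaceCauchy s t` in powers of `t`. -/
noncomputable def laplaceCauchySeries (s t : ℝ) : ℝ :=
  Real.pi / (2 * Real.sin (Real.pi * s / 2)) * Real.cos t -
    Real.pi / (2 * Real.cos (Real.pi * s / 2)) * Real.sin t + gammaSeries s t

lemma sin_pi_mul_add_one_div_two (s : ℝ) :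
    Real.sin (Real.pi * (s + 1) / 2) = Real.cos (Real.pi * s / 2) := by
  rw [show Real.pi * (s + 1) / 2 = Real.pi * s / 2 + Real.pi / 2 by ring, Real.sin_add_pi_div_two]

lemma cos_pi_mul_add_one_div_two (s : ℝ) :
    Real.cos (Real.pi * (s + 1) / 2) = -Real.sin (Real.pi * s / 2) := by
  rw [show Real.pi * (s + 1) / 2 = Real.pi * s / 2 + Real.pi / 2 by ring, Real.cos_add_pi_div_two]

lemma hasDerivAt_laplaceCauchySeries {s : ℝ} (hs : ∀ n : ℤ, s ≠ n) {t : ℝ} (ht : 0 < t) :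
    HasDerivAt (laplaceCauchySeries s) (-laplaceCauchySeries (s + 1) t) t := by
  refine ((((Real.hasDerivAt_cos t).const_mul _).sub ((Real.hasDerivAt_sin t).const_mul _)).add
    (hasDerivAt_gammaSeries hs ht)).congr_deriv ?_
  rw [laplaceCauchySeries, sin_pi_mul_add_one_div_two, cos_pi_mul_add_one_div_two, mul_neg 2,
    div_neg]
  ring

lemma laplaceCauchySeries_add_two {s : ℝ} (hs : ∀ n : ℤ, s ≠ n) {t : ℝ} (ht : 0 < t) :
    laplaceCauchySeries (s + 2) t = Real.Gamma s * t ^ (-s) - laplaceCauchySeries s t := by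
  rw [laplaceCauchySeries, laplaceCauchySeries, gammaSeries_add_two hs ht,
    show Real.pi * (s + 2) / 2 = Real.pi * s / 2 + Real.pi by ring, Real.sin_add_pi,
    Real.cos_add_pi, mul_neg, mul_neg, div_neg, div_neg]
  ring

/-- For s < 2 all exponents 2n + 2 - s are positive, so only the cosine term survives at 0. -/
lemma tendsto_laplaceCauchySeries {s : ℝ} (hs : ∀ n : ℤ, s ≠ n) (h2 : s < 2) :
    Tendsto (laplaceCauchySeries s) (𝓝[>] 0)
      (𝓝 (Real.pi / (2 * Real.sin (Real.pi * s / 2)))) := by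
  have h1 : ContinuousAt (fun t => Real.pi / (2 * Real.sin (Real.pi * s / 2)) * Real.cos t -
    Real.pi / (2 * Real.cos (Real.pi * s / 2)) * Real.sin t) 0 := by fun_prop
  have h := (h1.tendsto.mono_left (nhdsWithin_le_nhds (s := Ioi 0))).add
    (tendsto_tsum_mul_rpow (summable_gammaCoeff hs) (sub_pos.2 h2))
  rw [Real.cos_zero, Real.sin_zero, mul_one, mul_zero, sub_zero, add_zero] at h
  exact h

lemma add_one_ne_int {s : ℝ} (hs : ∀ n : ℤ, s ≠ n) (n : ℤ) : s + 1 ≠ n :=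
  fun h => hs (n - 1) (by push_cast; linarith)

lemma ne_int_of_mem_Ioo {s : ℝ} (h : s ∈ Ioo (0 : ℝ) 1) (n : ℤ) : s ≠ n := by
  rintro rfl
  have h1 : (0 : ℤ) < n := by exact_mod_cast h.1
  have h2 : n < (1 : ℤ) := by exact_mod_cast h.2
  omega

/-- The range 0 < s < 1 puts both s and s + 1 in (0, 2), where the limits at 0 are known. -/
lemma laplaceCauchy_eq_series_of_mem_Ioo {s : ℝ} (h : s ∈ Ioo (0 : ℝ) 1) {t : ℝ} (ht : 0 < t) :
    laplaceCauchy s t = laplaceCauchySeries s t ∧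
      laplaceCauchy (s + 1) t = laplaceCauchySeries (s + 1) t := by
  have hs := ne_int_of_mem_Ioo h
  obtain ⟨h0, h1⟩ := h
  set D := fun t => laplaceCauchy s t - laplaceCauchySeries s t
  set E := fun t => laplaceCauchy (s + 1) t - laplaceCauchySeries (s + 1) t
  have hD : ∀ t, 0 < t → HasDerivAt D (-E t) t := fun t ht =>
    ((hasDerivAt_laplaceCauchy h0 ht).sub (hasDerivAt_laplaceCauchySeries hs ht)).congr_deriv
      (by simp only [E]; ring)
  have hE : ∀ t, 0 < t → HasDerivAt E (D t) t := fun t ht =>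
    ((hasDerivAt_laplaceCauchy (by linarith) ht).sub
      (hasDerivAt_laplaceCauchySeries (add_one_ne_int hs) ht)).congr_deriv (by
        rw [add_assoc, one_add_one_eq_two, laplaceCauchy_add_two h0 ht,
          laplaceCauchySeries_add_two hs ht]
        simp only [D]; ring)
  have hD0 : Tendsto D (𝓝[>] 0) (𝓝 0) := by
    simpa using (tendsto_laplaceCauchy h0 (by linarith)).sub
      (tendsto_laplaceCauchySeries hs (by linarith))
  have hE0 : Tendsto E (𝓝[>] 0) (𝓝 0) := by
    simpa using (tendsto_laplaceCauchy (s := s + 1) (by linarith) (by linarith)).sub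
      (tendsto_laplaceCauchySeries (add_one_ne_int hs) (by linarith))
  -- D' = -E and E' = D, so this energy has derivative zero.
  have key : D t ^ 2 + E t ^ 2 = 0 := by
    refine eq_zero_of_hasDerivAt_zero (f := fun t => D t ^ 2 + E t ^ 2) (fun t ht => ?_) ?_ ht
    · exact (((hD t ht).pow 2).add ((hE t ht).pow 2)).congr_deriv (by ring)
    · simpa using (hD0.pow 2).add (hE0.pow 2)
  have hD1 : D t = 0 := by nlinarith [sq_nonneg (D t), sq_nonneg (E t)]
  have hE1 : E t = 0 := by nlinarith [sq_nonneg (D t), sq_nonneg (E t)]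
  exact ⟨sub_eq_zero.1 hD1, sub_eq_zero.1 hE1⟩

theorem laplaceCauchy_eq_series {s : ℝ} (h0 : 0 < s) (hs : ∀ n : ℤ, s ≠ n) {t : ℝ} (ht : 0 < t) :
    laplaceCauchy s t = laplaceCauchySeries s t := by
  -- Split s into integer and fractional part; the fractional part is nonzero because s is not an
  -- integer. The recurrence moves in steps of two, hence two base cases.
  suffices h : ∀ n : ℕ, ∀ s ∈ Ioo (0 : ℝ) 1,
      laplaceCauchy (s + n) t = laplaceCauchySeries (s + n) t by
    have h1 : (⌊s⌋₊ : ℝ) ≤ s := Nat.floor_le h0.le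
    have h2 : (⌊s⌋₊ : ℝ) ≠ s := fun h => hs ⌊s⌋₊ (by rw [← h]; simp)
    have := h ⌊s⌋₊ (s - ⌊s⌋₊) ⟨sub_pos.2 (lt_of_le_of_ne h1 h2), by
      linarith [Nat.lt_floor_add_one s]⟩
    simpa using this
  intro n
  induction n using Nat.twoStepInduction with
  | zero => exact fun s hs => by simpa using (laplaceCauchy_eq_series_of_mem_Ioo hs ht).1
  | one => exact fun s hs => by simpa using (laplaceCauchy_eq_series_of_mem_Ioo hs ht).2
  | more n ih _ =>
    intro s hs
    have hn : ∀ m : ℤ, s + n ≠ m := fun m h =>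
      ne_int_of_mem_Ioo hs (m - n) (by push_cast; linarith)
    have hpos : 0 < s + n := add_pos_of_pos_of_nonneg hs.1 (Nat.cast_nonneg n)
    push_cast
    rw [← add_assoc, laplaceCauchy_add_two hpos ht, laplaceCauchySeries_add_two hn ht, ih s hs]

/-! ### The logarithmic integral `∫ log (t² + y²) y^(s-1) e^(-y) dy` -/

lemma integrableOn_rpow_mul_exp_neg_one {s : ℝ} (hs : 0 < s) :
    IntegrableOn (fun y : ℝ => y ^ (s - 1) * Real.exp (-y)) (Ioi 0) := by
  simpa using integrableOn_rpow_mul_exp_neg hs one_pos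

lemma integrableOn_sq_mul_rpow_mul_exp {s : ℝ} (hs : 0 < s) :
    IntegrableOn (fun y : ℝ => y ^ 2 * (y ^ (s - 1) * Real.exp (-y))) (Ioi 0) := by
  refine (integrableOn_rpow_mul_exp_neg_one (s := s + 2) (by linarith)).congr_fun ?_
    measurableSet_Ioi
  intro y hy
  have hy0 : 0 < y := hy
  beta_reduce
  rw [show s + 2 - 1 = (s - 1) + 2 by ring, Real.rpow_add hy0, Real.rpow_two]
  ring

lemma abs_log_le_rpow_add_sq {s y : ℝ} (hs : 0 < s) (hy : 0 < y) :
    |Real.log y| ≤ 1 / s * y ^ (-s) + (1 + y ^ 2) := by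
  rcases le_total y 1 with h | h
  · have h1 := (Real.abs_log_mul_self_rpow_lt y s hy h hs).le
    rw [abs_mul, abs_of_pos (Real.rpow_pos_of_pos hy s)] at h1
    rw [Real.rpow_neg hy.le, ← div_eq_mul_inv]
    have := (le_div_iff₀ (Real.rpow_pos_of_pos hy s)).2 h1
    nlinarith [sq_nonneg y]
  · rw [abs_of_nonneg (Real.log_nonneg h)]
    have h1 := Real.log_le_sub_one_of_pos hy
    have h2 : 0 ≤ 1 / s * y ^ (-s) := by positivity
    nlinarith

lemma integrableOn_abs_log_mul_rpow_mul_exp {s : ℝ} (hs : 0 < s) :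
    IntegrableOn (fun y : ℝ => |Real.log y| * (y ^ (s - 1) * Real.exp (-y))) (Ioi 0) := by
  -- The logarithm is bounded using exponent s/2, so that y^(-s/2) still leaves the integrable
  -- singularity y^(s/2-1).
  have h1 := ((integrableOn_rpow_mul_exp_neg_one (half_pos hs)).const_mul (1 / (s / 2))).add
    ((integrableOn_rpow_mul_exp_neg_one hs).add (integrableOn_sq_mul_rpow_mul_exp hs))
  refine Integrable.mono' h1 (Measurable.aestronglyMeasurable (by fun_prop)) ?_
  filter_upwards [ae_restrict_mem measurableSet_Ioi] with y hy
  have hy0 : 0 < y := hy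
  rw [Real.norm_of_nonneg (by positivity)]
  refine (mul_le_mul_of_nonneg_right (abs_log_le_rpow_add_sq (half_pos hs) hy0)
    (by positivity)).trans (le_of_eq ?_)
  simp only [Pi.add_apply]
  rw [show s - 1 = (s / 2 - 1) + s / 2 by ring, Real.rpow_add hy0, Real.rpow_neg hy0.le]
  have : y ^ (s / 2) ≠ 0 := by positivity
  field_simp

/-- Differentiating Euler's integral under the sign gives Γ'(s), and Γ' = Γψ. The derivative is
taken in ℂ, where the digamma function is defined, and turns out real. -/
lemma integral_log_mul_rpow_mul_exp {s : ℝ} (hs : 0 < s) :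
    ∫ y in Ioi (0 : ℝ), Real.log y * (y ^ (s - 1) * Real.exp (-y)) =
      Real.Gamma s * realDigamma s := by
  have hre : 0 < (s : ℂ).re := by simpa using hs
  have h1 := Complex.hasDerivAt_GammaIntegral hre
  have h2 : HasDerivAt Complex.Gamma
      (∫ t : ℝ in Ioi 0, (t : ℂ) ^ ((s : ℂ) - 1) * (Real.log t * Real.exp (-t))) s := by
    refine h1.congr_of_eventuallyEq ?_
    filter_upwards [(isOpen_lt continuous_const Complex.continuous_re).mem_nhds hre] with z hz
    exact Complex.Gamma_eq_integral hz
  have h3 : (∫ t : ℝ in Ioi 0, (t : ℂ) ^ ((s : ℂ) - 1) * (Real.log t * Real.exp (-t))) =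
      ((∫ y in Ioi (0 : ℝ), Real.log y * (y ^ (s - 1) * Real.exp (-y)) : ℝ) : ℂ) := by
    rw [← integral_complex_ofReal]
    refine setIntegral_congr_fun measurableSet_Ioi fun y hy => ?_
    have hy0 : (0 : ℝ) < y := hy
    push_cast [Complex.ofReal_cpow hy0.le]
    ring
  rw [h3] at h2
  have hG : Real.Gamma s ≠ 0 := (Real.Gamma_pos_of_pos hs).ne'
  rw [realDigamma, Complex.digamma, logDeriv_apply, h2.deriv, Complex.Gamma_ofReal,
    ← Complex.ofReal_div, Complex.ofReal_re]
  field_simp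

/-- The integral `∫ log (t² + y²) y^(s-1) e^(-y) dy` over the positive half-line. -/
noncomputable def logGammaIntegral (s t : ℝ) : ℝ :=
  ∫ y in Ioi (0 : ℝ), Real.log (t ^ 2 + y ^ 2) * (y ^ (s - 1) * Real.exp (-y))

lemma abs_log_sq_add_sq_le {t y : ℝ} (ht : 0 < t) :
    |Real.log (t ^ 2 + y ^ 2)| ≤ |Real.log (t ^ 2)| + t ^ 2 + y ^ 2 := by
  have h1 : Real.log (t ^ 2) ≤ Real.log (t ^ 2 + y ^ 2) :=
    Real.log_le_log (by positivity) (by nlinarith)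
  have h2 := Real.log_le_sub_one_of_pos (by positivity : 0 < t ^ 2 + y ^ 2)
  have h3 := neg_abs_le (Real.log (t ^ 2))
  have h4 := abs_nonneg (Real.log (t ^ 2))
  rw [abs_le]
  constructor <;> nlinarith [sq_nonneg t, sq_nonneg y]

lemma integrableOn_logGammaIntegral {s t : ℝ} (hs : 0 < s) (ht : 0 < t) :
    IntegrableOn (fun y : ℝ => Real.log (t ^ 2 + y ^ 2) * (y ^ (s - 1) * Real.exp (-y)))
      (Ioi 0) := by
  have h1 := ((integrableOn_rpow_mul_exp_neg_one hs).const_mul (|Real.log (t ^ 2)| + t ^ 2)).add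
    (integrableOn_sq_mul_rpow_mul_exp hs)
  refine Integrable.mono' h1 (Measurable.aestronglyMeasurable (by fun_prop)) ?_
  filter_upwards [ae_restrict_mem measurableSet_Ioi] with y hy
  have hy0 : 0 < y := hy
  have h0 : 0 ≤ y ^ (s - 1) * Real.exp (-y) := by positivity
  rw [norm_mul, Real.norm_eq_abs, Real.norm_of_nonneg h0]
  refine (mul_le_mul_of_nonneg_right (abs_log_sq_add_sq_le ht) h0).trans (le_of_eq ?_)
  simp only [Pi.add_apply]
  ring

/-- The rescaling y ↦ ty turns t² + y² into t²(1 + y²) and e^(-y) into e^(-ty). -/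
lemma integral_rpow_mul_exp_div_sq_add_sq (s : ℝ) {t : ℝ} (ht : 0 < t) :
    ∫ y in Ioi (0 : ℝ), 2 * t / (t ^ 2 + y ^ 2) * (y ^ (s - 1) * Real.exp (-y)) =
      2 * t ^ (s - 1) * laplaceCauchy s t := by
  have h := integral_comp_mul_left_Ioi
    (fun y : ℝ => 2 * t / (t ^ 2 + y ^ 2) * (y ^ (s - 1) * Real.exp (-y))) 0 ht
  rw [mul_zero, smul_eq_mul] at h
  rw [eq_inv_mul_iff_mul_eq₀ ht.ne'] at h
  rw [← h, laplaceCauchy, ← integral_const_mul, ← integral_const_mul]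
  refine setIntegral_congr_fun measurableSet_Ioi fun y hy => ?_
  have hy0 : (0 : ℝ) < y := hy
  rw [Real.mul_rpow ht.le hy0.le, show t ^ 2 + (t * y) ^ 2 = t ^ 2 * (1 + y ^ 2) by ring]
  field_simp

lemma hasDerivAt_logGammaIntegral {s t : ℝ} (hs : 0 < s) (ht : 0 < t) :
    HasDerivAt (logGammaIntegral s) (2 * t ^ (s - 1) * laplaceCauchy s t) t := by
  rw [← integral_rpow_mul_exp_div_sq_add_sq s ht]
  have hmem : Ioi (t / 2) ∈ 𝓝 t := Ioi_mem_nhds (by linarith)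
  refine (hasDerivAt_integral_of_dominated_loc_of_deriv_le
    (μ := volume.restrict (Ioi (0 : ℝ)))
    (F := fun t y : ℝ => Real.log (t ^ 2 + y ^ 2) * (y ^ (s - 1) * Real.exp (-y)))
    (F' := fun t y : ℝ => 2 * t / (t ^ 2 + y ^ 2) * (y ^ (s - 1) * Real.exp (-y)))
    -- For x > t/2, 2x/(x² + y²) ≤ 2/x < 4/t.
    (bound := fun y : ℝ => 4 / t * (y ^ (s - 1) * Real.exp (-y))) (x₀ := t) hmem
    (Eventually.of_forall fun x => Measurable.aestronglyMeasurable (by fun_prop))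
    (integrableOn_logGammaIntegral hs ht) (Measurable.aestronglyMeasurable (by fun_prop)) ?_
    ((integrableOn_rpow_mul_exp_neg_one hs).const_mul _) ?_).2
  · filter_upwards [ae_restrict_mem measurableSet_Ioi] with y hy x hx
    have hy0 : 0 < y := hy
    have hx0 : t / 2 < x := hx
    have hx1 : 0 < x := by linarith
    rw [Real.norm_of_nonneg (by positivity)]
    refine mul_le_mul_of_nonneg_right ?_ (by positivity)
    rw [div_le_div_iff₀ (by positivity) ht]
    nlinarith [sq_nonneg y]
  · filter_upwards [ae_restrict_mem measurableSet_Ioi] with y hy x hx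
    have hy0 : 0 < y := hy
    have hne : x ^ 2 + y ^ 2 ≠ 0 := by positivity
    have h1 : HasDerivAt (fun x : ℝ => x ^ 2 + y ^ 2) (2 * x) x := by
      simpa using ((hasDerivAt_id x).pow 2).add_const (y ^ 2)
    exact (h1.log hne).mul_const _

lemma tendsto_logGammaIntegral {s : ℝ} (hs : 0 < s) :
    Tendsto (logGammaIntegral s) (𝓝[>] 0) (𝓝 (2 * (Real.Gamma s * realDigamma s))) := by
  rw [← integral_log_mul_rpow_mul_exp hs, ← integral_const_mul]
  refine tendsto_integral_filter_of_dominated_convergence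
    -- For 0 < t < 1, log y² ≤ log(t² + y²) ≤ t² + y² - 1 ≤ y².
    (fun y : ℝ => 2 * (|Real.log y| * (y ^ (s - 1) * Real.exp (-y))) +
      y ^ 2 * (y ^ (s - 1) * Real.exp (-y)))
    (Eventually.of_forall fun x => Measurable.aestronglyMeasurable (by fun_prop)) ?_
    (((integrableOn_abs_log_mul_rpow_mul_exp hs).const_mul 2).add
      (integrableOn_sq_mul_rpow_mul_exp hs)) ?_
  · filter_upwards [Ioo_mem_nhdsGT (zero_lt_one' ℝ)] with t ht
    filter_upwards [ae_restrict_mem measurableSet_Ioi] with y hy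
    have hy0 : 0 < y := hy
    have h0 : 0 ≤ y ^ (s - 1) * Real.exp (-y) := by positivity
    rw [norm_mul, Real.norm_eq_abs, Real.norm_of_nonneg h0, ← mul_assoc 2, ← add_mul]
    refine mul_le_mul_of_nonneg_right ?_ h0
    have h1 : Real.log (y ^ 2) ≤ Real.log (t ^ 2 + y ^ 2) :=
      Real.log_le_log (by positivity) (by nlinarith)
    rw [Real.log_pow] at h1
    push_cast at h1
    have h2 := Real.log_le_sub_one_of_pos (by positivity : 0 < t ^ 2 + y ^ 2)
    have h3 := neg_abs_le (Real.log y)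
    have h4 := abs_nonneg (Real.log y)
    have h5 : t ^ 2 ≤ 1 := by nlinarith [ht.1, ht.2]
    rw [abs_le]
    constructor <;> nlinarith [sq_nonneg y]
  · filter_upwards [ae_restrict_mem measurableSet_Ioi] with y hy
    have hy0 : (0 : ℝ) < y := hy
    have : ContinuousAt
        (fun t : ℝ => Real.log (t ^ 2 + y ^ 2) * (y ^ (s - 1) * Real.exp (-y))) 0 := by
      refine ContinuousAt.mul (ContinuousAt.log (by fun_prop) (by positivity)) (by fun_prop)
    have h := this.tendsto.mono_left (nhdsWithin_le_nhds (s := Ioi 0))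
    simpa [mul_assoc] using h

/-- The coefficients of `∫ τ^(a-1) cos τ` (for `k = 0`) and `∫ τ^(a-1) sin τ` (for `k = 1`). -/
noncomputable def trigCoeff (a : ℝ) (k n : ℕ) : ℝ :=
  (-1) ^ n / ((2 * n + k).factorial * (2 * (n : ℝ) + (a + k)))

lemma summable_trigCoeff {a : ℝ} (ha : 0 < a) (k : ℕ) (x : ℝ) :
    Summable fun n : ℕ => trigCoeff a k n * x ^ n := by
  refine Summable.of_norm_bounded ((Real.summable_pow_div_factorial |x|).mul_right (1 / a))
    fun n => ?_
  have h1 : (n.factorial : ℝ) ≤ (2 * n + k).factorial := by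
    exact_mod_cast Nat.factorial_le (by omega)
  have h2 : a ≤ 2 * (n : ℝ) + (a + k) := by
    have : (0 : ℝ) ≤ n := Nat.cast_nonneg n
    have : (0 : ℝ) ≤ k := Nat.cast_nonneg k
    linarith
  have h3 : (0 : ℝ) < n.factorial := by positivity
  rw [trigCoeff, norm_mul, norm_div, norm_pow, norm_neg, norm_one, one_pow, norm_pow,
    Real.norm_eq_abs x, Real.norm_of_nonneg (by positivity), div_mul_div_comm, div_mul_eq_mul_div,
    one_mul, mul_one]
  gcongr

/-- Differentiation cancels the linear denominator of `trigCoeff`, leaving t^(a-1) times the Taylor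
series of cosine (k = 0) or sine (k = 1). -/
lemma tsum_trigCoeff_mul {a t : ℝ} (ha : 0 < a) (ht : 0 < t) (k : ℕ) :
    ∑' n : ℕ, trigCoeff a k n * ((2 * (n : ℝ) + (a + k)) * t ^ (2 * (n : ℝ) + (a + k) - 1)) =
      t ^ (a - 1) * ∑' n : ℕ, (-1) ^ n * t ^ (2 * n + k) / (2 * n + k).factorial := by
  rw [← tsum_mul_left]
  refine tsum_congr fun n => ?_
  have h2 : 2 * (n : ℝ) + (a + k) ≠ 0 := by positivity
  rw [trigCoeff, show 2 * (n : ℝ) + (a + k) - 1 = 2 * n + (k + (a - 1)) by ring,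
    rpow_two_mul_nat_add ht, Real.rpow_add ht, Real.rpow_natCast, pow_add, pow_mul]
  field_simp

lemma summable_gammaCoeff_div {s : ℝ} (hs : ∀ n : ℤ, s ≠ n) (x : ℝ) :
    Summable fun n : ℕ => gammaCoeff s n / (n + 1) * x ^ n := by
  refine Summable.of_norm_bounded (summable_gammaCoeff hs x).norm fun n => ?_
  rw [norm_mul, norm_mul, norm_div, Real.norm_of_nonneg (by positivity : (0 : ℝ) ≤ n + 1)]
  refine mul_le_mul_of_nonneg_right (div_le_self (norm_nonneg _) ?_) (norm_nonneg _)
  linarith [(Nat.cast_nonneg n : (0 : ℝ) ≤ n)]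

/-- The expansion of `logGammaIntegral s t` in powers of `t`. -/
noncomputable def logGammaSeries (s t : ℝ) : ℝ :=
  2 * (Real.Gamma s * realDigamma s) +
    (Real.pi / Real.sin (Real.pi * s / 2) *
        ∑' n : ℕ, trigCoeff s 0 n * t ^ (2 * (n : ℝ) + (s + (0 : ℕ))) -
      Real.pi / Real.cos (Real.pi * s / 2) *
        ∑' n : ℕ, trigCoeff s 1 n * t ^ (2 * (n : ℝ) + (s + (1 : ℕ))) +
      ∑' n : ℕ, gammaCoeff s n / (n + 1) * t ^ (2 * (n : ℝ) + 2))

lemma hasDerivAt_logGammaSeries {s : ℝ} (h0 : 0 < s) (hs : ∀ n : ℤ, s ≠ n) {t : ℝ} (ht : 0 < t) :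
    HasDerivAt (logGammaSeries s) (2 * t ^ (s - 1) * laplaceCauchySeries s t) t := by
  refine (((((hasDerivAt_tsum_mul_rpow (summable_trigCoeff h0 0) _ ht).const_mul _).sub
    ((hasDerivAt_tsum_mul_rpow (summable_trigCoeff h0 1) _ ht).const_mul _)).add
    (hasDerivAt_tsum_mul_rpow (summable_gammaCoeff_div hs) 2 ht)).const_add _).congr_deriv ?_
  have h1 : ∑' n : ℕ, gammaCoeff s n / (n + 1) *
      ((2 * (n : ℝ) + 2) * t ^ (2 * (n : ℝ) + 2 - 1)) = 2 * t ^ (s - 1) * gammaSeries s t := by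
    rw [gammaSeries, ← tsum_mul_left]
    refine tsum_congr fun n => ?_
    have h2 : (n : ℝ) + 1 ≠ 0 := by positivity
    rw [show 2 * (n : ℝ) + 2 - 1 = (s - 1) + (2 * n + (2 - s)) by ring, Real.rpow_add ht (s - 1)]
    field_simp
  rw [tsum_trigCoeff_mul h0 ht, tsum_trigCoeff_mul h0 ht, h1, laplaceCauchySeries,
    Real.cos_eq_tsum t, Real.sin_eq_tsum t]
  simp only [add_zero]
  field_simp

lemma tendsto_logGammaSeries {s : ℝ} (h0 : 0 < s) (hs : ∀ n : ℤ, s ≠ n) :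
    Tendsto (logGammaSeries s) (𝓝[>] 0) (𝓝 (2 * (Real.Gamma s * realDigamma s))) := by
  have h := (((((tendsto_tsum_mul_rpow (p := s + (0 : ℕ)) (summable_trigCoeff h0 0)
      (by positivity)).const_mul (Real.pi / Real.sin (Real.pi * s / 2))).sub
    ((tendsto_tsum_mul_rpow (p := s + (1 : ℕ)) (summable_trigCoeff h0 1)
      (by positivity)).const_mul (Real.pi / Real.cos (Real.pi * s / 2)))).add
    (tendsto_tsum_mul_rpow (summable_gammaCoeff_div hs) two_pos)).const_add
      (2 * (Real.Gamma s * realDigamma s)))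
  rw [mul_zero, mul_zero, sub_zero, add_zero, add_zero] at h
  exact h

theorem logGammaIntegral_eq_series {s : ℝ} (h0 : 0 < s) (hs : ∀ n : ℤ, s ≠ n) {t : ℝ}
    (ht : 0 < t) : logGammaIntegral s t = logGammaSeries s t := by
  refine sub_eq_zero.1 (eq_zero_of_hasDerivAt_zero
    (f := fun t => logGammaIntegral s t - logGammaSeries s t) (fun t ht => ?_) ?_ ht)
  · refine ((hasDerivAt_logGammaIntegral h0 ht).sub
      (hasDerivAt_logGammaSeries h0 hs ht)).congr_deriv ?_
    rw [laplaceCauchy_eq_series h0 hs ht, sub_self]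
  · simpa using (tendsto_logGammaIntegral h0).sub (tendsto_logGammaSeries h0 hs)

/-! ### Hypergeometric form -/

/-- In the form (a)ₙ/(1+a)ₙ = a/(a+n), this converts the linear denominators of the integrated
series into hypergeometric parameters. -/
lemma ascPochhammer_eval_mul_add (a : ℝ) (n : ℕ) :
    (ascPochhammer ℝ n).eval a * (a + n) = a * (ascPochhammer ℝ n).eval (1 + a) := by
  rw [← ascPochhammer_succ_eval, ascPochhammer_succ_left]
  simp [add_comm]

lemma ascPochhammer_half_mul (n : ℕ) :
    (ascPochhammer ℝ n).eval (1 / 2) * 4 ^ n * n.factorial = (2 * n).factorial := by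
  induction n with
  | zero => simp
  | succ n ih =>
    rw [ascPochhammer_succ_eval, show 2 * (n + 1) = 2 * n + 1 + 1 by ring, Nat.factorial_succ,
      Nat.factorial_succ, Nat.factorial_succ]
    push_cast
    rw [← ih]
    ring

lemma ascPochhammer_three_half_mul (n : ℕ) :
    (ascPochhammer ℝ n).eval (3 / 2) * 4 ^ n * n.factorial = (2 * n + 1).factorial := by
  have h := ascPochhammer_eval_mul_add (1 / 2) n
  rw [show (1 : ℝ) + 1 / 2 = 3 / 2 by norm_num] at h
  rw [Nat.factorial_succ]
  push_cast
  rw [← ascPochhammer_half_mul]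
  linear_combination (-2 * 4 ^ n * (n.factorial : ℝ)) * h

lemma ascPochhammer_eval_ne_zero {a : ℝ} (h : ∀ n : ℕ, a + n ≠ 0) (n : ℕ) :
    (ascPochhammer ℝ n).eval a ≠ 0 := by
  induction n with
  | zero => simp
  | succ n ih =>
    rw [ascPochhammer_succ_eval]
    exact mul_ne_zero ih (h n)

/-- Each descent by two contributes (2n+3-s)(2n+4-s), that is 4 times one new factor of each
Pochhammer symbol. -/
lemma Gamma_sub_two_eq_gammaCoeff_mul {s : ℝ} (hs : ∀ n : ℤ, s ≠ n) (n : ℕ) :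
    Real.Gamma (s - 2) = Real.Gamma (s - 2 * n - 2) * 4 ^ n *
      ((ascPochhammer ℝ n).eval (3 / 2 - s / 2) * (ascPochhammer ℝ n).eval (2 - s / 2)) := by
  induction n with
  | zero => simp
  | succ n ih =>
    have h1 : s - 2 * n - 2 ≠ 1 := fun h => hs (2 * n + 3) (by push_cast; linarith)
    have h2 : s - 2 * n - 2 ≠ 2 := fun h => hs (2 * n + 4) (by push_cast; linarith)
    rw [ih, Gamma_sub_two h1 h2, ascPochhammer_succ_eval, ascPochhammer_succ_eval,
      show s - 2 * (n : ℝ) - 2 - 2 = s - 2 * (n + 1 : ℕ) - 2 by push_cast; ring]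
    generalize Real.Gamma (s - 2 * (n + 1 : ℕ) - 2) = G
    push_cast
    ring

lemma hypergeometricPFQ_trig_zero {s : ℝ} (h0 : 0 < s) (z : ℝ) :
    hypergeometricPFQ [s / 2] [1 / 2, 1 + s / 2] (-(z / 4)) =
      s * ∑' n : ℕ, trigCoeff s 0 n * z ^ n := by
  rw [hypergeometricPFQ, ← tsum_mul_left]
  refine tsum_congr fun n => ?_
  have h1 := ascPochhammer_eval_mul_add (s / 2) n
  have h2 := ascPochhammer_half_mul n
  have h3 : (ascPochhammer ℝ n).eval (1 + s / 2) ≠ 0 :=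
    ascPochhammer_eval_ne_zero (fun n => by positivity) n
  have h4 : (ascPochhammer ℝ n).eval (1 / 2 : ℝ) ≠ 0 :=
    ascPochhammer_eval_ne_zero (fun n => by positivity) n
  have h5 : 2 * (n : ℝ) + s ≠ 0 := by positivity
  simp only [List.map_cons, List.map_nil, List.prod_cons, List.prod_nil, mul_one, trigCoeff,
    add_zero, Nat.cast_zero]
  rw [← h2, show -(z / 4) = -1 * z / 4 by ring, div_pow, mul_pow]
  clear h2
  generalize (ascPochhammer ℝ n).eval (1 + s / 2) = A at *
  generalize (ascPochhammer ℝ n).eval (s / 2) = B at *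
  field_simp
  linear_combination 2 * z ^ n * h1

lemma hypergeometricPFQ_trig_one {s : ℝ} (h0 : 0 < s) (z : ℝ) :
    hypergeometricPFQ [1 / 2 + s / 2] [3 / 2, 3 / 2 + s / 2] (-(z / 4)) =
      (1 + s) * ∑' n : ℕ, trigCoeff s 1 n * z ^ n := by
  rw [hypergeometricPFQ, ← tsum_mul_left]
  refine tsum_congr fun n => ?_
  have h1 := ascPochhammer_eval_mul_add (1 / 2 + s / 2) n
  rw [show 1 + (1 / 2 + s / 2) = 3 / 2 + s / 2 by ring] at h1
  have h2 := ascPochhammer_three_half_mul n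
  have h3 : (ascPochhammer ℝ n).eval (3 / 2 + s / 2) ≠ 0 :=
    ascPochhammer_eval_ne_zero (fun n => by positivity) n
  have h4 : (ascPochhammer ℝ n).eval (3 / 2 : ℝ) ≠ 0 :=
    ascPochhammer_eval_ne_zero (fun n => by positivity) n
  have h5 : 2 * (n : ℝ) + (s + 1) ≠ 0 := by positivity
  simp only [List.map_cons, List.map_nil, List.prod_cons, List.prod_nil, mul_one, trigCoeff,
    Nat.cast_one]
  rw [← h2, show -(z / 4) = -1 * z / 4 by ring, div_pow, mul_pow]
  clear h2
  generalize (ascPochhammer ℝ n).eval (3 / 2 + s / 2) = A at *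
  generalize (ascPochhammer ℝ n).eval (1 / 2 + s / 2) = B at *
  field_simp
  linear_combination 2 * z ^ n * h1

/-- The parameters 1, 1 over 2, with the n!, give (1)ₙ(1)ₙ/((2)ₙ n!) = 1/(n+1), the factor left by
integration. -/
lemma hypergeometricPFQ_gamma {s : ℝ} (hs : ∀ n : ℤ, s ≠ n) (z : ℝ) :
    Real.Gamma (s - 2) * hypergeometricPFQ [1, 1] [2, 3 / 2 - s / 2, 2 - s / 2] (-(z / 4)) =
      ∑' n : ℕ, gammaCoeff s n / (n + 1) * z ^ n := by
  rw [hypergeometricPFQ, ← tsum_mul_left]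
  refine tsum_congr fun n => ?_
  have h1 : (ascPochhammer ℝ n).eval (1 : ℝ) = n.factorial := ascPochhammer_eval_one ℝ n
  have h2 : (ascPochhammer ℝ n).eval (2 : ℝ) = (n + 1) * n.factorial := by
    have := ascPochhammer_eval_mul_add 1 n
    rw [h1, one_add_one_eq_two, one_mul] at this
    rw [← this]
    ring
  have h3 : (ascPochhammer ℝ n).eval (3 / 2 - s / 2) ≠ 0 :=
    ascPochhammer_eval_ne_zero (fun n h => hs (2 * n + 3) (by push_cast; linarith)) n
  have h4 : (ascPochhammer ℝ n).eval (2 - s / 2) ≠ 0 :=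
    ascPochhammer_eval_ne_zero (fun n h => hs (2 * n + 4) (by push_cast; linarith)) n
  simp only [List.map_cons, List.map_nil, List.prod_cons, List.prod_nil, mul_one, gammaCoeff, h1,
    h2]
  rw [Gamma_sub_two_eq_gammaCoeff_mul hs n, show -(z / 4) = -1 * z / 4 by ring, div_pow, mul_pow]
  generalize (ascPochhammer ℝ n).eval (3 / 2 - s / 2) = A at *
  generalize (ascPochhammer ℝ n).eval (2 - s / 2) = B at *
  field_simp

lemma tsum_mul_rpow {t : ℝ} (ht : 0 < t) (c : ℕ → ℝ) (p : ℝ) :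
    ∑' n : ℕ, c n * t ^ (2 * (n : ℝ) + p) = t ^ p * ∑' n : ℕ, c n * (t ^ 2) ^ n := by
  rw [← tsum_mul_left]
  refine tsum_congr fun n => ?_
  rw [rpow_two_mul_nat_add ht]
  ring

theorem capacityClosedForm_eq {α β ρ₀ t : ℝ} (hα : 0 < α) (hint : ∀ n : ℤ, α ≠ n) (ht : 0 < t)
    (hz : 1 / (β ^ 2 * ρ₀) = t ^ 2) :
    capacityClosedForm α β ρ₀ =
      (logGammaSeries α t - Real.Gamma α * Real.log (t ^ 2)) / (Real.Gamma α * Real.log 2) := by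
  have hG : Real.Gamma α ≠ 0 := (Real.Gamma_pos_of_pos hα).ne'
  have h4 : 1 / (4 * β ^ 2 * ρ₀) = t ^ 2 / 4 := by
    rw [← hz, div_div]
    ring_nf
  have h1 : (t ^ 2) ^ (α / 2) = t ^ α := by
    rw [← Real.rpow_natCast, ← Real.rpow_mul ht.le]
    congr 1
    push_cast
    ring
  have h2 : (t ^ 2) ^ ((1 + α) / 2) = t ^ (α + 1) := by
    rw [← Real.rpow_natCast, ← Real.rpow_mul ht.le]
    congr 1
    push_cast
    ring
  have h5 : Real.Gamma α = (α - 1) * (α - 2) * Real.Gamma (α - 2) :=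
    Gamma_sub_two (by simpa using hint 1) (by simpa using hint 2)
  -- The cubic is (1 + α)(α - 1)(α - 2), so the logarithm and digamma terms have total coefficient
  -- one after the prefactor.
  have h6 : (2 - α - 2 * α ^ 2 + α ^ 3) * Real.Gamma (α - 2) = (1 + α) * Real.Gamma α := by
    rw [h5]
    ring
  have hα1 : 1 + α ≠ 0 := by positivity
  rw [capacityClosedForm, h4, hz, h1, h2, hypergeometricPFQ_trig_zero hα,
    hypergeometricPFQ_trig_one hα, div_mul_eq_mul_div (Real.Gamma (α - 2)),
    div_mul_eq_mul_div _ (Real.Gamma α), mul_right_comm (Real.Gamma (α - 2)),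
    hypergeometricPFQ_gamma hint, h6, logGammaSeries, tsum_mul_rpow ht, tsum_mul_rpow ht,
    tsum_mul_rpow ht, Real.rpow_two]
  push_cast
  rw [add_zero]
  generalize (∑' n : ℕ, trigCoeff α 0 n * (t ^ 2) ^ n) = X
  generalize (∑' n : ℕ, trigCoeff α 1 n * (t ^ 2) ^ n) = Y
  generalize (∑' n : ℕ, gammaCoeff α n / (n + 1) * (t ^ 2) ^ n) = Z
  have hl : Real.log 2 ≠ 0 := (Real.log_pos one_lt_two).ne'
  simp only [div_eq_mul_inv, one_mul, mul_inv]
  field_simp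
  ring

/-! ### Densities on the positive half-line -/

lemma withDensity_ite_pos (f : ℝ → ℝ) :
    (volume.withDensity fun x => ENNReal.ofReal (if 0 < x then f x else 0)) =
      (volume.restrict (Ioi 0)).withDensity fun x => ENNReal.ofReal (f x) := by
  rw [← withDensity_indicator measurableSet_Ioi]
  congr 1
  ext x
  by_cases hx : 0 < x <;> simp [hx]

lemma integral_withDensity_ite_pos {f : ℝ → ℝ} (hf : Measurable f) (h0 : ∀ x, 0 < x → 0 ≤ f x)
    (g : ℝ → ℝ) :
    ∫ x, g x ∂(volume.withDensity fun x => ENNReal.ofReal (if 0 < x then f x else 0)) =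
      ∫ x in Ioi (0 : ℝ), f x * g x := by
  rw [withDensity_ite_pos, integral_withDensity_eq_integral_toReal_smul (by fun_prop)
    (ae_of_all _ fun _ => ENNReal.ofReal_lt_top)]
  refine setIntegral_congr_fun measurableSet_Ioi fun x hx => ?_
  simp [ENNReal.toReal_ofReal (h0 x hx)]

lemma integrable_withDensity_ite_pos_iff {f : ℝ → ℝ} (hf : Measurable f)
    (h0 : ∀ x, 0 < x → 0 ≤ f x) (g : ℝ → ℝ) :
    Integrable g (volume.withDensity fun x => ENNReal.ofReal (if 0 < x then f x else 0)) ↔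
      IntegrableOn (fun x => f x * g x) (Ioi 0) := by
  rw [withDensity_ite_pos, integrable_withDensity_iff_integrable_smul' (by fun_prop)
    (ae_of_all _ fun _ => ENNReal.ofReal_lt_top)]
  refine integrable_congr ?_
  filter_upwards [ae_restrict_mem measurableSet_Ioi] with x hx
  simp [ENNReal.toReal_ofReal (h0 x hx)]

/-! ### The approximate SNR law -/

/-- The density of the approximate SNR law on the positive half-line. -/
noncomputable def snrDensity (α β ρ₀ x : ℝ) : ℝ :=
  1 / (2 * β ^ α * Real.Gamma α) * ρ₀ ^ (-(α / 2)) * x ^ ((α - 2) / 2) *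
    Real.exp (-Real.sqrt (x / (β ^ 2 * ρ₀)))

lemma snrLaw_eq (α β ρ₀ : ℝ) : snrLaw α β ρ₀ =
    volume.withDensity fun x => ENNReal.ofReal (if 0 < x then snrDensity α β ρ₀ x else 0) := rfl

lemma measurable_snrDensity (α β ρ₀ : ℝ) : Measurable (snrDensity α β ρ₀) := by
  unfold snrDensity
  fun_prop

lemma snrDensity_nonneg {α β ρ₀ : ℝ} (hα : 0 < α) (hβ : 0 < β) (hρ : 0 < ρ₀) (x : ℝ)
    (hx : 0 < x) : 0 ≤ snrDensity α β ρ₀ x := by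
  have := Real.Gamma_pos_of_pos hα
  unfold snrDensity
  positivity

lemma mul_snrDensity_sq {α β ρ₀ t y : ℝ} (hβ : 0 < β) (hρ : 0 < ρ₀)
    (ht : 0 < t) (hz : 1 / (β ^ 2 * ρ₀) = t ^ 2) (hy : 0 < y) :
    1 / t * (2 * (1 / t * y)) * snrDensity α β ρ₀ ((1 / t * y) ^ 2) =
      1 / Real.Gamma α * (y ^ (α - 1) * Real.exp (-y)) := by
  have hρ' : ρ₀ = (1 / (t * β)) ^ 2 := by
    field_simp at hz ⊢
    linarith
  have h1 : (1 / t * y) ^ 2 / (β ^ 2 * ρ₀) = y ^ 2 := by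
    rw [hρ']
    field_simp
  have h2 : ρ₀ ^ (-(α / 2)) = (t * β) ^ α := by
    rw [hρ', ← Real.rpow_natCast, ← Real.rpow_mul (by positivity), one_div,
      Real.inv_rpow (by positivity), ← Real.rpow_neg (by positivity)]
    congr 1
    push_cast
    ring
  have h3 : ((1 / t * y) ^ 2) ^ ((α - 2) / 2) = t ^ (-α) * t ^ 2 * (y ^ (α - 1) / y) := by
    rw [← Real.rpow_natCast, ← Real.rpow_mul (by positivity), Real.mul_rpow (by positivity) hy.le,
      one_div, Real.inv_rpow ht.le, ← Real.rpow_neg ht.le, ← Real.rpow_two t, ← Real.rpow_add ht,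
      ← Real.rpow_sub_one hy.ne']
    push_cast
    congr 2 <;> ring
  rw [snrDensity, h1, h2, h3, Real.sqrt_sq hy.le, Real.mul_rpow ht.le hβ.le, Real.rpow_neg ht.le]
  have h4 : 0 < t ^ α := by positivity
  have h5 : 0 < β ^ α := by positivity
  -- α is unrestricted here; if Γ(α) = 0, both sides vanish by division by zero.
  by_cases hG : Real.Gamma α = 0
  · simp [hG]
  field_simp

/-- Substitution x = (y/t)², split into a square and a dilation. An arbitrary g serves both the
total mass and the capacity. -/
lemma snrDensity_substitution {α β ρ₀ t : ℝ} (hβ : 0 < β) (hρ : 0 < ρ₀)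
    (ht : 0 < t) (hz : 1 / (β ^ 2 * ρ₀) = t ^ 2) (g : ℝ → ℝ) :
    (IntegrableOn (fun x => snrDensity α β ρ₀ x * g x) (Ioi 0) ↔
      IntegrableOn (fun y => 1 / Real.Gamma α * (y ^ (α - 1) * Real.exp (-y)) *
        g ((1 / t * y) ^ 2)) (Ioi 0)) ∧
    ∫ x in Ioi (0 : ℝ), snrDensity α β ρ₀ x * g x =
      ∫ y in Ioi (0 : ℝ), 1 / Real.Gamma α * (y ^ (α - 1) * Real.exp (-y)) *
        g ((1 / t * y) ^ 2) := by
  have ht' : 0 < 1 / t := by positivity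
  set h : ℝ → ℝ := fun x => snrDensity α β ρ₀ x * g x with hh
  have key : ∀ y ∈ Ioi (0 : ℝ), 1 / Real.Gamma α * (y ^ (α - 1) * Real.exp (-y)) *
      g ((1 / t * y) ^ 2) =
      1 / t * (2 * (1 / t * y) ^ ((2 : ℝ) - 1) * h ((1 / t * y) ^ (2 : ℝ))) := by
    intro y hy
    rw [← mul_snrDensity_sq hβ hρ ht hz hy, Real.rpow_two, show (2 : ℝ) - 1 = 1 by norm_num,
      Real.rpow_one, hh]
    ring
  constructor
  · rw [integrableOn_congr_fun key measurableSet_Ioi, ← integrableOn_Ioi_comp_rpow_iff h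
      two_ne_zero, abs_two]
    simp only [smul_eq_mul]
    have h2 := integrableOn_Ioi_comp_mul_left_iff
      (fun x : ℝ => 2 * x ^ ((2 : ℝ) - 1) * h (x ^ (2 : ℝ))) 0 ht'
    rw [mul_zero] at h2
    rw [← h2]
    exact (integrable_const_mul_iff (isUnit_iff_ne_zero.2 ht'.ne') _).symm
  · rw [setIntegral_congr_fun measurableSet_Ioi key, integral_const_mul,
      ← integral_comp_rpow_Ioi_of_pos two_pos (g := h)]
    have h2 := integral_comp_mul_left_Ioi'
      (fun x : ℝ => 2 * x ^ ((2 : ℝ) - 1) * h (x ^ (2 : ℝ))) 0 ht'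
    rw [mul_zero] at h2
    simpa only [smul_eq_mul] using h2.symm

lemma exists_pos_sq_eq {β ρ₀ : ℝ} (hβ : 0 < β) (hρ : 0 < ρ₀) :
    ∃ t : ℝ, 0 < t ∧ 1 / (β ^ 2 * ρ₀) = t ^ 2 :=
  ⟨Real.sqrt (1 / (β ^ 2 * ρ₀)), by positivity, (Real.sq_sqrt (by positivity)).symm⟩

theorem isProbabilityMeasure_snrLaw {α β ρ₀ : ℝ} (hα : 0 < α) (hβ : 0 < β) (hρ : 0 < ρ₀) :
    IsProbabilityMeasure (snrLaw α β ρ₀) := by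
  obtain ⟨t, ht, hz⟩ := exists_pos_sq_eq hβ hρ
  have hsub := snrDensity_substitution (α := α) hβ hρ ht hz (fun _ => 1)
  have hint := (integrable_withDensity_ite_pos_iff (measurable_snrDensity α β ρ₀)
    (snrDensity_nonneg hα hβ hρ) (fun _ => 1)).2 (hsub.1.2 (by
      simp only [mul_one]
      exact (integrableOn_rpow_mul_exp_neg_one hα).const_mul (1 / Real.Gamma α)))
  have hval := (integral_withDensity_ite_pos (measurable_snrDensity α β ρ₀)
    (snrDensity_nonneg hα hβ hρ) (fun _ => 1)).trans hsub.2
  rw [← snrLaw_eq] at hint hval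
  have hfin : IsFiniteMeasure (snrLaw α β ρ₀) := by
    rwa [integrable_const_iff_isFiniteMeasure one_ne_zero] at hint
  have hG : ∫ y in Ioi (0 : ℝ), y ^ (α - 1) * Real.exp (-y) = Real.Gamma α := by
    rw [Real.Gamma_eq_integral hα]
    simp only [mul_comm]
  simp only [mul_one, integral_const_mul, hG, integral_const, smul_eq_mul] at hval
  rw [one_div, inv_mul_cancel₀ (Real.Gamma_pos_of_pos hα).ne'] at hval
  exact ⟨by rwa [measureReal_def, ENNReal.toReal_eq_one_iff] at hval⟩

lemma logb_one_add_sq {t y : ℝ} (ht : 0 < t) :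
    Real.logb 2 (1 + (1 / t * y) ^ 2) =
      (Real.log (t ^ 2 + y ^ 2) - Real.log (t ^ 2)) / Real.log 2 := by
  rw [Real.logb, ← Real.log_div (by positivity) (by positivity)]
  congr 2
  field_simp

theorem integrable_logb_snrLaw {α β ρ₀ : ℝ} (hα : 0 < α) (hβ : 0 < β) (hρ : 0 < ρ₀) :
    Integrable (fun x : ℝ => Real.logb 2 (1 + x)) (snrLaw α β ρ₀) := by
  obtain ⟨t, ht, hz⟩ := exists_pos_sq_eq hβ hρ
  rw [snrLaw_eq, integrable_withDensity_ite_pos_iff (measurable_snrDensity α β ρ₀)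
    (snrDensity_nonneg hα hβ hρ), (snrDensity_substitution hβ hρ ht hz _).1]
  refine (((integrableOn_logGammaIntegral hα ht).sub
    ((integrableOn_rpow_mul_exp_neg_one hα).const_mul (Real.log (t ^ 2)))).const_mul
      (1 / (Real.Gamma α * Real.log 2))).congr (ae_of_all _ fun y => ?_)
  have hl : Real.log 2 ≠ 0 := (Real.log_pos one_lt_two).ne'
  have hG : Real.Gamma α ≠ 0 := (Real.Gamma_pos_of_pos hα).ne'
  simp only [Pi.sub_apply]
  rw [logb_one_add_sq ht]
  field_simp

theorem ergodicCapacity_eq_closedForm {α β ρ₀ : ℝ} (hα : 0 < α) (hβ : 0 < β) (hρ : 0 < ρ₀)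
    (hn : ∀ n : ℕ, α ≠ n) : ergodicCapacity α β ρ₀ = capacityClosedForm α β ρ₀ := by
  obtain ⟨t, ht, hz⟩ := exists_pos_sq_eq hβ hρ
  have hint : ∀ n : ℤ, α ≠ n := by
    rintro n rfl
    have h0 : 0 ≤ n := by exact_mod_cast hα.le
    obtain ⟨m, rfl⟩ := Int.eq_ofNat_of_zero_le h0
    exact hn m (by simp)
  have hl : Real.log 2 ≠ 0 := (Real.log_pos one_lt_two).ne'
  have hG : Real.Gamma α ≠ 0 := (Real.Gamma_pos_of_pos hα).ne'
  have hG' : ∫ y in Ioi (0 : ℝ), y ^ (α - 1) * Real.exp (-y) = Real.Gamma α := by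
    rw [Real.Gamma_eq_integral hα]
    simp only [mul_comm]
  rw [capacityClosedForm_eq hα hint ht hz, ← logGammaIntegral_eq_series hα hint ht,
    ergodicCapacity, snrLaw_eq, integral_withDensity_ite_pos (measurable_snrDensity α β ρ₀)
    (snrDensity_nonneg hα hβ hρ), (snrDensity_substitution hβ hρ ht hz _).2]
  have h1 : ∀ y : ℝ, 1 / Real.Gamma α * (y ^ (α - 1) * Real.exp (-y)) *
      Real.logb 2 (1 + (1 / t * y) ^ 2) = 1 / (Real.Gamma α * Real.log 2) *
      (Real.log (t ^ 2 + y ^ 2) * (y ^ (α - 1) * Real.exp (-y)) -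
        Real.log (t ^ 2) * (y ^ (α - 1) * Real.exp (-y))) := fun y => by
    rw [logb_one_add_sq ht]
    field_simp
  simp only [h1]
  rw [integral_const_mul, integral_sub (integrableOn_logGammaIntegral hα ht)
    ((integrableOn_rpow_mul_exp_neg_one hα).const_mul _), integral_const_mul, hG']
  rw [logGammaIntegral]
  ring

/-! ### Moments of the κ–μ law -/

/-- The `k`-th term of the series expansion of the κ–μ density. -/
noncomputable def kappaMuTerm (κ μ : ℝ) (k : ℕ) (r : ℝ) : ℝ :=
  2 * (μ * (1 + κ)) ^ μ * Real.exp (-(κ * μ)) *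
    ((κ * μ * (μ * (1 + κ))) ^ k / ((k.factorial : ℝ) * Real.Gamma (μ + k))) *
    (r ^ (2 * μ - 1 + 2 * k) * Real.exp (-(μ * (1 + κ)) * r ^ (2 : ℝ)))

/-- The `k`-th term of the series for the `s`-th moment of the κ–μ law. -/
noncomputable def kappaMuMoment (κ μ s : ℝ) (k : ℕ) : ℝ :=
  Real.exp (-(κ * μ)) * ((κ * μ) ^ k / (k.factorial : ℝ)) *
    (Real.Gamma (μ + k + s / 2) / Real.Gamma (μ + k)) * (μ * (1 + κ)) ^ (-(s / 2))

section KappaMu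

variable {κ μ : ℝ}

lemma kappaMuTerm_nonneg (hκ : 0 ≤ κ) (hμ : 0 < μ) (k : ℕ) {r : ℝ} (hr : 0 < r) :
    0 ≤ kappaMuTerm κ μ k r := by
  have := Real.Gamma_pos_of_pos (by positivity : 0 < μ + k)
  unfold kappaMuTerm
  positivity

lemma measurable_kappaMuTerm (k : ℕ) : Measurable (kappaMuTerm κ μ k) := by
  unfold kappaMuTerm
  fun_prop

lemma summable_pow_div_factorial_mul_Gamma (hμ : 0 < μ) (x : ℝ) :
    Summable fun k : ℕ => x ^ k / ((k.factorial : ℝ) * Real.Gamma (μ + k)) := by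
  have h := summable_mul_pow_of_ratio_tendsto_zero
    (c := fun k : ℕ => 1 / ((k.factorial : ℝ) * Real.Gamma (μ + k)))
    -- This is 1/((k+1)(k+μ)), written to fit `tendsto_inv_mul_linear_zero`.
    (r := fun k : ℕ => 4 * ((2 * (k : ℝ) + 2) * (2 * k + 2 * μ))⁻¹) (fun k => ?_)
    (by simpa using (tendsto_inv_mul_linear_zero 2 (2 * μ)).const_mul 4) x
  · simpa [div_eq_inv_mul] using h
  · have h1 : 0 < μ + k := by positivity
    have h2 := Real.Gamma_pos_of_pos h1
    rw [Nat.factorial_succ]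
    push_cast
    rw [← add_assoc, Real.Gamma_add_one h1.ne']
    field_simp
    ring

lemma ofReal_kappaMuPDF (hκ : 0 ≤ κ) (hμ : 0 < μ) {r : ℝ} (hr : 0 < r) :
    ENNReal.ofReal (kappaMuPDF κ μ r) = ∑' k, ENNReal.ofReal (kappaMuTerm κ μ k r) := by
  have h : ∀ k : ℕ, kappaMuTerm κ μ k r =
      2 * (μ * (1 + κ)) ^ μ * r ^ (2 * μ - 1) * Real.exp (-(κ * μ) - μ * (1 + κ) * r ^ 2) *
        ((κ * μ * (μ * (1 + κ)) * r ^ 2) ^ k / ((k.factorial : ℝ) * Real.Gamma (μ + k))) := by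
    intro k
    rw [kappaMuTerm, Real.rpow_add hr, Real.rpow_two, sub_eq_add_neg (-(κ * μ)), Real.exp_add,
      mul_pow _ (r ^ 2), ← pow_mul, ← neg_mul, show r ^ (2 * (k : ℝ)) = r ^ (2 * k) by
        rw [← Real.rpow_natCast]; push_cast; rfl]
    ring_nf
  rw [← ENNReal.ofReal_tsum_of_nonneg (fun k => kappaMuTerm_nonneg hκ hμ k hr)]
  · simp only [h]
    rw [tsum_mul_left, kappaMuPDF, if_pos hr]
  · simp only [h]
    exact (summable_pow_div_factorial_mul_Gamma hμ _).mul_left _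

lemma kappaMuLaw_eq (hκ : 0 ≤ κ) (hμ : 0 < μ) :
    kappaMuLaw κ μ = (volume.restrict (Ioi 0)).withDensity
      fun r => ∑' k, ENNReal.ofReal (kappaMuTerm κ μ k r) := by
  rw [kappaMuLaw, ← withDensity_indicator measurableSet_Ioi]
  congr 1
  ext r
  by_cases hr : 0 < r
  · rw [indicator_of_mem (mem_Ioi.2 hr), ofReal_kappaMuPDF hκ hμ hr]
  · rw [indicator_of_notMem (by simpa using hr), kappaMuPDF, if_neg hr, ENNReal.ofReal_zero]

lemma integral_kappaMuTerm_mul_rpow (hκ : 0 ≤ κ) (hμ : 0 < μ) {s : ℝ} (hs : 0 ≤ s) (k : ℕ) :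
    IntegrableOn (fun r => kappaMuTerm κ μ k r * r ^ s) (Ioi 0) ∧
      ∫ r in Ioi (0 : ℝ), kappaMuTerm κ μ k r * r ^ s = kappaMuMoment κ μ s k := by
  have hb : 0 < μ * (1 + κ) := by positivity
  have hq : -1 < 2 * μ - 1 + 2 * k + s := by
    have : (0 : ℝ) ≤ k := Nat.cast_nonneg k
    linarith
  have key : ∀ r ∈ Ioi (0 : ℝ), kappaMuTerm κ μ k r * r ^ s =
      2 * (μ * (1 + κ)) ^ μ * Real.exp (-(κ * μ)) *
        ((κ * μ * (μ * (1 + κ))) ^ k / ((k.factorial : ℝ) * Real.Gamma (μ + k))) *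
        (r ^ (2 * μ - 1 + 2 * k + s) * Real.exp (-(μ * (1 + κ)) * r ^ (2 : ℝ))) := by
    intro r hr
    rw [kappaMuTerm, Real.rpow_add hr _ s]
    ring
  constructor
  · rw [integrableOn_congr_fun key measurableSet_Ioi]
    exact (integrableOn_rpow_mul_exp_neg_mul_rpow hq two_pos hb).const_mul _
  · rw [setIntegral_congr_fun measurableSet_Ioi key, integral_const_mul,
      integral_rpow_mul_exp_neg_mul_rpow two_pos hq hb, kappaMuMoment,
      show (2 * μ - 1 + 2 * k + s + 1) / 2 = μ + k + s / 2 by ring,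
      show -(2 * μ - 1 + 2 * k + s + 1) / 2 = -μ + (-(k : ℝ)) + (-(s / 2)) by ring,
      Real.rpow_add hb, Real.rpow_add hb, Real.rpow_neg hb.le, Real.rpow_neg hb.le,
      Real.rpow_natCast, mul_pow (κ * μ)]
    have h1 : (μ * (1 + κ)) ^ μ ≠ 0 := (Real.rpow_pos_of_pos hb _).ne'
    have h2 : (μ * (1 + κ)) ^ k ≠ 0 := (pow_pos hb _).ne'
    generalize (μ * (1 + κ)) ^ μ = B at *
    generalize (μ * (1 + κ)) ^ k = D at *
    generalize (μ * (1 + κ)) ^ (-(s / 2)) = E at *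
    field_simp

/-- Tonelli in extended nonnegative reals needs no summability; finiteness is decided later by the
sum of the moments. -/
lemma lintegral_rpow_kappaMuLaw (hκ : 0 ≤ κ) (hμ : 0 < μ) {s : ℝ} (hs : 0 ≤ s) :
    ∫⁻ r, ENNReal.ofReal (r ^ s) ∂kappaMuLaw κ μ =
      ∑' k, ENNReal.ofReal (kappaMuMoment κ μ s k) := by
  have hm : ∀ k, Measurable fun r => ENNReal.ofReal (kappaMuTerm κ μ k r) := fun k =>
    (measurable_kappaMuTerm k).ennreal_ofReal
  rw [kappaMuLaw_eq hκ hμ, lintegral_withDensity_eq_lintegral_mul _ (Measurable.tsum hm)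
    (by fun_prop)]
  simp only [Pi.mul_apply, ← ENNReal.tsum_mul_right]
  rw [lintegral_tsum (f := fun k r => ENNReal.ofReal (kappaMuTerm κ μ k r) * ENNReal.ofReal (r ^ s))
    fun k => ((hm k).mul (by fun_prop)).aemeasurable]
  refine tsum_congr fun k => ?_
  obtain ⟨h1, h2⟩ := integral_kappaMuTerm_mul_rpow hκ hμ hs k
  rw [← h2, ofReal_integral_eq_lintegral_ofReal h1]
  · refine setLIntegral_congr_fun measurableSet_Ioi fun r hr => ?_
    exact (ENNReal.ofReal_mul (kappaMuTerm_nonneg hκ hμ k hr)).symm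
  · filter_upwards [ae_restrict_mem measurableSet_Ioi] with r hr
    exact mul_nonneg (kappaMuTerm_nonneg hκ hμ k hr) (Real.rpow_nonneg (le_of_lt hr) _)

lemma ae_pos_kappaMuLaw (hκ : 0 ≤ κ) (hμ : 0 < μ) : ∀ᵐ r ∂kappaMuLaw κ μ, 0 < r := by
  rw [kappaMuLaw_eq hκ hμ]
  exact (withDensity_absolutelyContinuous _ _).ae_le (ae_restrict_mem measurableSet_Ioi)

lemma kappaMuMoment_nonneg (hκ : 0 ≤ κ) (hμ : 0 < μ) {s : ℝ} (hs : 0 ≤ s) (k : ℕ) :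
    0 ≤ kappaMuMoment κ μ s k := by
  have h1 := Real.Gamma_pos_of_pos (by positivity : 0 < μ + k)
  have h2 := Real.Gamma_pos_of_pos (by positivity : 0 < μ + k + s / 2)
  unfold kappaMuMoment
  positivity

lemma integral_rpow_kappaMuLaw (hκ : 0 ≤ κ) (hμ : 0 < μ) {s M : ℝ} (hs : 0 ≤ s)
    (hM : HasSum (kappaMuMoment κ μ s) M) :
    Integrable (fun r => r ^ s) (kappaMuLaw κ μ) ∧ ∫ r, r ^ s ∂kappaMuLaw κ μ = M := by
  have h0 : 0 ≤ᵐ[kappaMuLaw κ μ] fun r => r ^ s := by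
    filter_upwards [ae_pos_kappaMuLaw hκ hμ] with r hr using Real.rpow_nonneg hr.le _
  have hm : AEStronglyMeasurable (fun r : ℝ => r ^ s) (kappaMuLaw κ μ) :=
    Measurable.aestronglyMeasurable (by fun_prop)
  have h1 := lintegral_rpow_kappaMuLaw hκ hμ hs
  rw [← ENNReal.ofReal_tsum_of_nonneg (kappaMuMoment_nonneg hκ hμ hs) hM.summable,
    hM.tsum_eq] at h1
  constructor
  · rw [← lintegral_ofReal_ne_top_iff_integrable hm h0, h1]
    exact ENNReal.ofReal_ne_top
  · rw [integral_eq_lintegral_of_nonneg_ae h0 hm, h1, ENNReal.toReal_ofReal]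
    exact hM.nonneg (kappaMuMoment_nonneg hκ hμ hs)

lemma Gamma_add_nat {s : ℝ} (hs : 0 < s) (n : ℕ) :
    Real.Gamma (s + n) = Real.Gamma s * (ascPochhammer ℝ n).eval s := by
  induction n with
  | zero => simp
  | succ n ih =>
    push_cast
    rw [← add_assoc, Real.Gamma_add_one (by positivity), ih, ascPochhammer_succ_eval]
    ring

lemma hasSum_kappaMuMoment_one (hκ : 0 ≤ κ) (hμ : 0 < μ) :
    HasSum (kappaMuMoment κ μ 1) (kappaMuMean κ μ) := by
  have hb : 0 < (1 + κ) * μ := by positivity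
  set c : ℕ → ℝ := fun k => (ascPochhammer ℝ k).eval (μ + 1 / 2) / (ascPochhammer ℝ k).eval μ /
    (k.factorial : ℝ) with hc
  have hne : ∀ k : ℕ, (ascPochhammer ℝ k).eval μ ≠ 0 :=
    ascPochhammer_eval_ne_zero fun n => by positivity
  have hs : Summable fun k => c k * (κ * μ) ^ k := by
    refine summable_mul_pow_of_ratio_tendsto_zero
      -- This is the ratio (μ + 1/2 + k)/((μ + k)(k + 1)).
      (r := fun k : ℕ => ((k : ℝ) + 1)⁻¹ * (1 + 2⁻¹ * ((k : ℝ) + μ)⁻¹)) (fun k => ?_) ?_ _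
    · have h1 : (k : ℝ) + μ ≠ 0 := by positivity
      have h2 : μ + k ≠ 0 := by positivity
      have h3 := hne k
      simp only [hc]
      rw [ascPochhammer_succ_eval, ascPochhammer_succ_eval, Nat.factorial_succ]
      push_cast
      field_simp
      ring
    · have h : ∀ a : ℝ, Tendsto (fun n : ℕ => ((n : ℝ) + a)⁻¹) atTop (𝓝 0) := fun a =>
        (tendsto_atTop_add_const_right _ a tendsto_natCast_atTop_atTop).inv_tendsto_atTop
      simpa using (h 1).mul (((h μ).const_mul 2⁻¹).const_add 1)
  have key : ∀ k, kappaMuMoment κ μ 1 k = Real.Gamma (μ + 1 / 2) * Real.exp (-(κ * μ)) /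
      (Real.Gamma μ * ((1 + κ) * μ) ^ (1 / 2 : ℝ)) * (c k * (κ * μ) ^ k) := by
    intro k
    have h1 := hne k
    have h2 := (Real.Gamma_pos_of_pos hμ).ne'
    have h3 : ((1 + κ) * μ) ^ (1 / 2 : ℝ) ≠ 0 := (Real.rpow_pos_of_pos hb _).ne'
    rw [kappaMuMoment, add_right_comm, Gamma_add_nat (by positivity), Gamma_add_nat hμ,
      mul_comm μ (1 + κ), Real.rpow_neg hb.le]
    simp only [hc]
    field_simp
  have h4 : hypergeometricPFQ [μ + 1 / 2] [μ] (κ * μ) = ∑' k, c k * (κ * μ) ^ k := by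
    refine tsum_congr fun k => ?_
    simp only [List.map_cons, List.map_nil, List.prod_cons, List.prod_nil, mul_one, hc]
    ring
  rw [kappaMuMean, h4, funext key]
  exact hs.hasSum.mul_left _

/-- Γ(μ+k+1)/Γ(μ+k) = μ + k, so the sum is the mean of μ + K, for K Poisson with parameter κμ,
divided by μ(1+κ). -/
lemma hasSum_kappaMuMoment_two (hκ : 0 ≤ κ) (hμ : 0 < μ) :
    HasSum (kappaMuMoment κ μ 2) 1 := by
  have hb : 0 < μ * (1 + κ) := by positivity
  have h1 : HasSum (fun k : ℕ => (κ * μ) ^ k / (k.factorial : ℝ)) (Real.exp (κ * μ)) := by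
    rw [Real.exp_eq_exp_ℝ]
    exact NormedSpace.expSeries_div_hasSum_exp (κ * μ)
  have h2 : HasSum (fun k : ℕ => (k : ℝ) * ((κ * μ) ^ k / (k.factorial : ℝ)))
      (κ * μ * Real.exp (κ * μ)) := by
    rw [← hasSum_nat_add_iff' 1]
    simp only [Finset.range_one, Finset.sum_singleton, Nat.cast_zero, zero_mul, sub_zero]
    refine (h1.mul_left (κ * μ)).congr_fun fun k => ?_
    rw [Nat.factorial_succ, pow_succ]
    push_cast
    field_simp
  have h3 := ((h1.mul_left μ).add h2).mul_left (Real.exp (-(κ * μ)) * (μ * (1 + κ))⁻¹)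
  have h6 : Real.exp (-(κ * μ)) * (μ * (1 + κ))⁻¹ *
      (μ * Real.exp (κ * μ) + κ * μ * Real.exp (κ * μ)) = 1 := by
    rw [Real.exp_neg]
    field_simp
  rw [h6] at h3
  refine h3.congr_fun fun k => ?_
  have h4 : 0 < μ + k := by positivity
  have h5 := (Real.Gamma_pos_of_pos h4).ne'
  rw [kappaMuMoment, show (2 : ℝ) / 2 = 1 by norm_num, Real.Gamma_add_one h4.ne',
    Real.rpow_neg_one]
  field_simp

theorem integrable_id_kappaMuLaw (hκ : 0 ≤ κ) (hμ : 0 < μ) :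
    Integrable (fun r : ℝ => r) (kappaMuLaw κ μ) ∧ ∫ r, r ∂kappaMuLaw κ μ = kappaMuMean κ μ := by
  simpa using integral_rpow_kappaMuLaw hκ hμ zero_le_one (hasSum_kappaMuMoment_one hκ hμ)

theorem integrable_sq_kappaMuLaw (hκ : 0 ≤ κ) (hμ : 0 < μ) :
    Integrable (fun r : ℝ => r ^ 2) (kappaMuLaw κ μ) ∧ ∫ r, r ^ 2 ∂kappaMuLaw κ μ = 1 := by
  simpa using integral_rpow_kappaMuLaw hκ hμ zero_le_two (hasSum_kappaMuMoment_two hκ hμ)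

end KappaMu

/-! ### Moments of the path gains -/

lemma measurable_pathGain (η H : ℝ) : Measurable (pathGain η H) := by
  unfold pathGain
  exact Measurable.ite (measurableSet_singleton ∞) measurable_const (by fun_prop)

lemma pathGain_top (η H : ℝ) : pathGain η H ∞ = 0 := by simp [pathGain]

lemma pathGain_nonneg (η H : ℝ) (w : ℝ≥0∞) : 0 ≤ pathGain η H w := by
  unfold pathGain
  split_ifs
  · exact le_rfl
  · positivity

lemma pathGain_pos (η : ℝ) {H : ℝ} (hH : 0 < H) {w : ℝ≥0∞} (hw : w ≠ ∞) : 0 < pathGain η H w := by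
  rw [pathGain, if_neg hw]
  positivity

lemma pathGain_le {η H : ℝ} (hη : 0 < η) (hH : 0 < H) (w : ℝ≥0∞) :
    pathGain η H w ≤ H ^ (-(η / 2)) := by
  unfold pathGain
  split_ifs
  · positivity
  · refine Real.rpow_le_rpow_of_nonpos hH ?_ (by linarith)
    exact Real.le_sqrt_of_sq_le (by nlinarith [sq_nonneg w.toReal])

lemma pathGain_ofReal_pow (η : ℝ) {H : ℝ} (hH : 0 < H) {w : ℝ} (hw : 0 ≤ w) (t : ℕ) :
    pathGain η H (ENNReal.ofReal w) ^ t = (w ^ 2 + H ^ 2) ^ (-(t * η / 4)) := by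
  rw [pathGain, if_neg ENNReal.ofReal_ne_top, ENNReal.toReal_ofReal hw, ← Real.rpow_natCast,
    ← Real.rpow_mul (by positivity), Real.sqrt_eq_rpow, ← Real.rpow_mul (by positivity)]
  congr 1
  ring

lemma integral_map_ofReal_withDensity {f : ℝ → ℝ} (hf : Measurable f)
    (h0 : ∀ x, 0 < x → 0 ≤ f x) (η : ℝ) {H : ℝ} (hH : 0 < H) (t : ℕ) :
    ∫ w, pathGain η H w ^ t ∂((volume.withDensity fun x =>
      ENNReal.ofReal (if 0 < x then f x else 0)).map ENNReal.ofReal) =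
      ∫ w in Ioi (0 : ℝ), f w * (w ^ 2 + H ^ 2) ^ (-(t * η / 4)) := by
  rw [integral_map ENNReal.measurable_ofReal.aemeasurable
    ((measurable_pathGain η H).pow_const t).aestronglyMeasurable,
    integral_withDensity_ite_pos hf h0]
  refine setIntegral_congr_fun measurableSet_Ioi fun w hw => ?_
  simp only [pathGain_ofReal_pow η hH (le_of_lt hw)]

namespace HAPNetwork

variable (S : HAPNetwork)

/-- The density vanishes at 0, so weak and strict positivity give the same function. -/
lemma distHAPLaw_eq : S.distHAPLaw = (volume.withDensity fun x => ENNReal.ofReal (if 0 < x then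
    2 * S.lamHAP * Real.pi * x * Real.exp (-(S.lamHAP * Real.pi * x ^ 2)) else 0)).map
      ENNReal.ofReal := by
  rw [distHAPLaw]
  congr 2
  ext w
  congr 1
  rw [distHAPPDF]
  rcases lt_trichotomy w 0 with h | rfl | h
  · rw [if_neg h.not_ge, if_neg h.not_gt]
  · simp
  · rw [if_pos h.le, if_pos h]

lemma distHAPLaw_top : S.distHAPLaw {∞} = 0 := by
  rw [distHAPLaw, Measure.map_apply ENNReal.measurable_ofReal (measurableSet_singleton _)]
  have : ENNReal.ofReal ⁻¹' {∞} = ∅ := by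
    ext w
    simp
  rw [this, measure_empty]

/-- Substituting x = πλ(w² + H²) maps the half-line onto the range of the incomplete Gamma integral
and absorbs the linear factor of the density. -/
theorem integral_pathGain_distHAPLaw (η : ℝ) {H : ℝ} (hH : 0 < H) (t : ℕ) :
    ∫ w, pathGain η H w ^ t ∂S.distHAPLaw = S.momentHAP η H t := by
  have hl := S.lamHAP_pos
  have hπ := Real.pi_pos
  rw [distHAPLaw_eq, integral_map_ofReal_withDensity (by fun_prop)
    (fun x hx => by positivity) η hH t, momentHAP, upperIncompleteGamma]
  have himg : (fun w : ℝ => Real.pi * S.lamHAP * (w ^ 2 + H ^ 2)) '' Ioi 0 =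
      Ioi (H ^ 2 * S.lamHAP * Real.pi) := by
    ext x
    constructor
    · rintro ⟨w, hw, rfl⟩
      have h1 : 0 < Real.pi * S.lamHAP * w ^ 2 := by
        have : (0 : ℝ) < w := hw
        positivity
      simp only [mem_Ioi]
      linarith
    · intro hx
      have hx' : H ^ 2 * S.lamHAP * Real.pi < x := hx
      have h2 : H ^ 2 < x / (Real.pi * S.lamHAP) := by
        rw [lt_div_iff₀ (by positivity)]
        linarith
      refine ⟨Real.sqrt (x / (Real.pi * S.lamHAP) - H ^ 2), Real.sqrt_pos.2 (sub_pos.2 h2), ?_⟩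
      beta_reduce
      rw [Real.sq_sqrt (sub_nonneg.2 h2.le), sub_add_cancel]
      field_simp
  have hinj : InjOn (fun w : ℝ => Real.pi * S.lamHAP * (w ^ 2 + H ^ 2)) (Ioi 0) := by
    intro a ha b hb hab
    have h1 : a ^ 2 = b ^ 2 := by
      have := mul_left_cancel₀ (by positivity : Real.pi * S.lamHAP ≠ 0) hab
      linarith
    exact (pow_left_inj₀ (le_of_lt ha) (le_of_lt hb) two_ne_zero).1 h1
  rw [← himg, integral_image_eq_integral_abs_deriv_smul measurableSet_Ioi
    (f' := fun w => Real.pi * S.lamHAP * (2 * w)) (fun w _ => ?_) hinj, ← integral_const_mul]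
  · refine setIntegral_congr_fun measurableSet_Ioi fun w hw => ?_
    have hw0 : (0 : ℝ) < w := hw
    have hc : 0 < Real.pi * S.lamHAP := by positivity
    rw [abs_of_pos (by positivity), smul_eq_mul, Real.mul_rpow hc.le (by positivity),
      show 1 - η * t / 4 - 1 = -(t * η / 4) by ring, Real.rpow_neg hc.le, mul_comm η,
      show -(Real.pi * S.lamHAP * (w ^ 2 + H ^ 2)) =
        -(S.lamHAP * Real.pi * w ^ 2) + -(Real.pi * H ^ 2 * S.lamHAP) by ring, Real.exp_add,
      Real.exp_neg (Real.pi * H ^ 2 * S.lamHAP)]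
    have h1 : (Real.pi * S.lamHAP) ^ ((t : ℝ) * η / 4) ≠ 0 := (Real.rpow_pos_of_pos hc _).ne'
    field_simp
  · have h1 : HasDerivAt (fun w : ℝ => w ^ 2 + H ^ 2) (2 * w) w := by
      simpa using ((hasDerivAt_id w).pow 2).add_const (H ^ 2)
    exact (h1.const_mul _).hasDerivWithinAt

/-- The probability that no RIS is visible. -/
noncomputable def noRISProb : ℝ :=
  Real.exp (-(2 * Real.pi * S.muRIS * (Real.exp (-S.blockP) / S.upsilon ^ 2)))

lemma upsilon_pos : 0 < S.upsilon := by
  have h1 := S.lamB_pos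
  have h2 := S.meanLength_pos
  have h3 := S.meanWidth_pos
  unfold upsilon
  positivity

lemma noRISProb_pos : 0 < S.noRISProb := Real.exp_pos _

lemma noRISProb_lt_one : S.noRISProb < 1 := by
  have h1 := S.muRIS_pos
  have h2 := S.upsilon_pos
  rw [noRISProb, Real.exp_lt_one_iff, neg_lt_zero]
  positivity

/-- The density of the distance to the nearest visible RIS on the positive half-line. -/
noncomputable def distRISDensity (w : ℝ) : ℝ :=
  2 * Real.pi * S.muRIS * w *
    Real.exp (-(S.upsilon * w + S.blockP + 2 * Real.pi * S.muRIS * S.blockU w))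

lemma measurable_distRISDensity : Measurable S.distRISDensity := by
  unfold distRISDensity blockU
  fun_prop

lemma distRISDensity_nonneg (w : ℝ) (hw : 0 < w) : 0 ≤ S.distRISDensity w := by
  have h1 := S.muRIS_pos
  unfold distRISDensity
  positivity

lemma distRISLaw_eq : S.distRISLaw = (volume.withDensity fun x => ENNReal.ofReal (if 0 < x then
    S.distRISDensity x else 0)).map ENNReal.ofReal +
      ENNReal.ofReal S.noRISProb • Measure.dirac ∞ := by
  rw [distRISLaw]
  congr 3
  ext w
  congr 1
  rw [distRISPDF]
  rcases lt_trichotomy w 0 with h | rfl | h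
  · rw [if_neg h.not_ge, if_neg h.not_gt]
  · simp
  · rw [if_pos h.le, if_pos h, distRISDensity]

lemma distRISLaw_top : S.distRISLaw {∞} = ENNReal.ofReal S.noRISProb := by
  rw [distRISLaw, Measure.add_apply, Measure.map_apply ENNReal.measurable_ofReal
    (measurableSet_singleton _)]
  have : ENNReal.ofReal ⁻¹' {∞} = ∅ := by
    ext w
    simp
  rw [this, measure_empty, zero_add, Measure.smul_apply, Measure.dirac_apply_of_mem
    (mem_singleton _), smul_eq_mul, mul_one, noRISProb]

/-- The atom at ∞ contributes 0^t, which is 0 only because t ≠ 0. -/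
theorem integral_pathGain_distRISLaw {t : ℕ} (ht : t ≠ 0) [IsFiniteMeasure S.distRISLaw] :
    ∫ w, pathGain S.expG S.heightRIS w ^ t ∂S.distRISLaw = S.momentRIS t := by
  have hint : Integrable (fun w => pathGain S.expG S.heightRIS w ^ t) S.distRISLaw := by
    refine Integrable.of_bound (C := (S.heightRIS ^ (-(S.expG / 2))) ^ t)
      ((measurable_pathGain _ _).pow_const t).aestronglyMeasurable (ae_of_all _ fun w => ?_)
    rw [norm_pow, Real.norm_of_nonneg (pathGain_nonneg _ _ _)]
    exact pow_le_pow_left₀ (pathGain_nonneg _ _ _) (pathGain_le S.expG_pos S.heightRIS_pos w) t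
  rw [distRISLaw_eq] at hint ⊢
  rw [integral_add_measure (hint.mono_measure (Measure.le_add_right le_rfl))
    (hint.mono_measure (Measure.le_add_left le_rfl)), integral_smul_measure, integral_dirac,
    pathGain_top, zero_pow ht, smul_zero, add_zero,
    integral_map_ofReal_withDensity S.measurable_distRISDensity S.distRISDensity_nonneg _
    S.heightRIS_pos, momentRIS, ← integral_const_mul]
  refine setIntegral_congr_fun measurableSet_Ioi fun w _ => ?_
  rw [distRISDensity, blockU, show -(S.upsilon * w + S.blockP + 2 * Real.pi * S.muRIS *
    (Real.exp (-S.blockP) / S.upsilon ^ 2 *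
      (1 - (S.upsilon * w + 1) * Real.exp (-(S.upsilon * w))))) = -S.blockP +
    -(S.upsilon * w + 2 * Real.pi * S.muRIS * (Real.exp (-S.blockP) / S.upsilon ^ 2 *
      (1 - (S.upsilon * w + 1) * Real.exp (-(S.upsilon * w))))) by ring,
    Real.exp_add (-S.blockP)]
  ring

end HAPNetwork

/-! ### Independent products -/

section IndepProducts

variable {Ω : Type*} [MeasurableSpace Ω] {P : Measure Ω} {X Y : Ω → ℝ}

lemma ProbabilityTheory.IndepFun.integral_mul_sq (h : IndepFun X Y P)
    (hX : AEStronglyMeasurable X P) (hY : AEStronglyMeasurable Y P) :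
    ∫ ω, (X ω * Y ω) ^ 2 ∂P = (∫ ω, X ω ^ 2 ∂P) * ∫ ω, Y ω ^ 2 ∂P := by
  simp only [mul_pow]
  have h2 : IndepFun (fun ω => X ω ^ 2) (fun ω => Y ω ^ 2) P :=
    h.comp (measurable_id.pow_const 2) (measurable_id.pow_const 2)
  exact h2.integral_fun_mul_eq_mul_integral (hX.pow 2) (hY.pow 2)

lemma ProbabilityTheory.IndepFun.memLp_two_mul (h : IndepFun X Y P) (hX : MemLp X 2 P)
    (hY : MemLp Y 2 P) : MemLp (fun ω => X ω * Y ω) 2 P := by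
  refine (memLp_two_iff_integrable_sq (hX.1.mul hY.1)).2 ?_
  simp only [Pi.mul_apply, mul_pow]
  have h2 : IndepFun (fun ω => X ω ^ 2) (fun ω => Y ω ^ 2) P :=
    h.comp (measurable_id.pow_const 2) (measurable_id.pow_const 2)
  exact h2.integrable_mul hX.integrable_sq hY.integrable_sq

lemma integral_pos_of_nonneg_of_not_ae_zero (hX : Integrable X P) (h0 : ∀ ω, 0 ≤ X ω)
    (hne : ¬ ∀ᵐ ω ∂P, X ω = 0) : 0 < ∫ ω, X ω ∂P := by
  refine lt_of_le_of_ne (integral_nonneg h0) fun h => hne ?_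
  exact (integral_eq_zero_iff_of_nonneg h0 hX).1 h.symm

lemma memLp_two_of_hasLaw_kappaMu {κ μ : ℝ} (hκ : 0 ≤ κ) (hμ : 0 < μ)
    (h : HasLaw X (kappaMuLaw κ μ) P) :
    MemLp X 2 P ∧ ∫ ω, X ω ∂P = kappaMuMean κ μ ∧ ∫ ω, X ω ^ 2 ∂P = 1 := by
  have hm : AEStronglyMeasurable X P := h.aemeasurable.aestronglyMeasurable
  refine ⟨?_, ?_, ?_⟩
  · rw [memLp_two_iff_integrable_sq hm]
    have h1 := (integrable_sq_kappaMuLaw hκ hμ).1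
    rw [← h.map_eq] at h1
    exact h1.comp_aemeasurable h.aemeasurable
  · exact (h.integral_comp aestronglyMeasurable_id).trans (integrable_id_kappaMuLaw hκ hμ).2
  · exact (h.integral_comp (f := fun r : ℝ => r ^ 2)
      (measurable_id.pow_const 2).aestronglyMeasurable).trans (integrable_sq_kappaMuLaw hκ hμ).2

/-- A nonnegative variable of mean zero vanishes almost everywhere, against second moment 1. -/
lemma kappaMuMean_pos_of_hasLaw [IsFiniteMeasure P] {κ μ : ℝ} (hκ : 0 ≤ κ) (hμ : 0 < μ)
    (h0 : ∀ ω, 0 ≤ X ω) (h : HasLaw X (kappaMuLaw κ μ) P) : 0 < kappaMuMean κ μ := by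
  obtain ⟨h1, h2, h3⟩ := memLp_two_of_hasLaw_kappaMu hκ hμ h
  rw [← h2]
  refine integral_pos_of_nonneg_of_not_ae_zero (h1.integrable one_le_two) h0 fun hz => ?_
  have : ∫ ω, X ω ^ 2 ∂P = 0 := integral_eq_zero_of_ae (by
    filter_upwards [hz] with ω hω
    simp [hω])
  linarith

lemma memLp_pathGain [IsFiniteMeasure P] {η H : ℝ} (hη : 0 < η) (hH : 0 < H)
    {D : Ω → ℝ≥0∞} (hD : Measurable D) :
    MemLp (fun ω => pathGain η H (D ω)) 2 P := by
  refine MemLp.of_bound ((measurable_pathGain η H).comp hD).aestronglyMeasurable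
    (H ^ (-(η / 2))) (ae_of_all _ fun ω => ?_)
  rw [Real.norm_of_nonneg (pathGain_nonneg _ _ _)]
  exact pathGain_le hη hH _

lemma integral_pathGain_pow_of_hasLaw {η H : ℝ} {D : Ω → ℝ≥0∞} {ν : Measure ℝ≥0∞}
    (hD : HasLaw D ν P) (t : ℕ) :
    ∫ ω, pathGain η H (D ω) ^ t ∂P = ∫ w, pathGain η H w ^ t ∂ν :=
  hD.integral_comp (f := fun w => pathGain η H w ^ t)
    ((measurable_pathGain η H).pow_const t).aestronglyMeasurable

lemma not_ae_pathGain_eq_zero [IsProbabilityMeasure P] (η : ℝ) {H : ℝ} (hH : 0 < H)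
    {D : Ω → ℝ≥0∞} {ν : Measure ℝ≥0∞} (hD : HasLaw D ν P) (hν : ν {∞} < 1) : ¬ ∀ᵐ ω ∂P, pathGain η H (D ω) = 0 := by
  intro h
  have h1 : ∀ᵐ ω ∂P, D ω = ∞ := by
    filter_upwards [h] with ω hω
    by_contra hne
    exact (pathGain_pos η hH hne).ne' hω
  have h2 : P {ω | D ω = ∞} = 1 := mem_ae_iff_prob_eq_one₀
    (hD.aemeasurable.nullMeasurableSet_preimage (measurableSet_singleton _)) |>.1 h1
  rw [hD.measure_eq (p := fun w => w = ∞) (measurableSet_singleton _)] at h2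
  exact hν.ne h2

end IndepProducts

/-! ### The combined channel response -/

/-- The phase shift cancels the arguments of a and b, leaving the common phase θ. Zero factors are
covered too. -/
lemma mul_mul_exp_sub_arg (a b : ℂ) (θ : ℝ) :
    a * b * Complex.exp (Complex.I * ((θ - (Complex.arg a + Complex.arg b) : ℝ) : ℂ)) =
      ((‖a‖ * ‖b‖ : ℝ) : ℂ) * Complex.exp (θ * Complex.I) := by
  have h : Complex.exp (θ * Complex.I) = Complex.exp (Complex.arg a * Complex.I) *
      Complex.exp (Complex.arg b * Complex.I) *
      Complex.exp (Complex.I * ((θ - (Complex.arg a + Complex.arg b) : ℝ) : ℂ)) := by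
    rw [← Complex.exp_add, ← Complex.exp_add]
    congr 1
    push_cast
    ring
  conv_lhs => arg 1; rw [← Complex.norm_mul_exp_arg_mul_I a, ← Complex.norm_mul_exp_arg_mul_I b]
  rw [h]
  push_cast
  ring

namespace HAPChannel

variable {S : HAPNetwork} {Ω : Type*} [MeasurableSpace Ω] {P : Measure Ω} (C : HAPChannel S P)

/-- The values of the independent sources of randomness. -/
noncomputable def sourceVal (s : ChannelSource S.numRE) (ω : Ω) : ℝ≥0∞ :=
  match s with
  | .q l => ‖C.q l ω‖ₑ
  | .g l => ‖C.g l ω‖ₑ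
  | .u => ‖C.u ω‖ₑ
  | .distQ => C.distQ ω
  | .distG => C.distG ω
  | .distU => C.distU ω

/-- The σ-algebra generated by a set of sources. -/
noncomputable abbrev sourceSigma (A : Set (ChannelSource S.numRE)) : MeasurableSpace Ω :=
  ⨆ s ∈ A, MeasurableSpace.comap (C.sourceVal s) inferInstance

lemma measurable_sourceVal (s : ChannelSource S.numRE) : Measurable (C.sourceVal s) := by
  cases s with
  | q l => exact (C.measurable_q l).enorm
  | g l => exact (C.measurable_g l).enorm
  | u => exact C.measurable_u.enorm
  | distQ => exact C.measurable_distQ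
  | distG => exact C.measurable_distG
  | distU => exact C.measurable_distU

lemma measurable_sourceVal_sourceSigma {A : Set (ChannelSource S.numRE)}
    {s : ChannelSource S.numRE} (hs : s ∈ A) : Measurable[C.sourceSigma A] (C.sourceVal s) :=
  Measurable.of_comap_le (le_iSup₂_of_le s hs le_rfl)

/-- All independence claims below reduce to this: functions of disjoint sets of sources are
independent. -/
lemma indepFun_of_disjoint {A B : Set (ChannelSource S.numRE)} (hAB : Disjoint A B)
    {f g : Ω → ℝ} (hf : Measurable[C.sourceSigma A] f) (hg : Measurable[C.sourceSigma B] g) :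
    IndepFun f g P := by
  have h1 : iIndepFun C.sourceVal P := by
    convert C.indep using 1
    ext s ω
    cases s <;> rfl
  have h2 := indep_iSup_of_disjoint
    (fun s => measurable_iff_comap_le.1 (C.measurable_sourceVal s)) h1 hAB
  exact indep_of_indep_of_le_left (indep_of_indep_of_le_right h2 (measurable_iff_comap_le.1 hg))
    (measurable_iff_comap_le.1 hf)

lemma measurable_norm_q {A : Set (ChannelSource S.numRE)} {l : Fin S.numRE} (h : .q l ∈ A) :
    Measurable[C.sourceSigma A] fun ω => ‖C.q l ω‖ := by
  simpa [sourceVal] using (C.measurable_sourceVal_sourceSigma h).ennreal_toReal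

lemma measurable_norm_g {A : Set (ChannelSource S.numRE)} {l : Fin S.numRE} (h : .g l ∈ A) :
    Measurable[C.sourceSigma A] fun ω => ‖C.g l ω‖ := by
  simpa [sourceVal] using (C.measurable_sourceVal_sourceSigma h).ennreal_toReal

lemma measurable_norm_u {A : Set (ChannelSource S.numRE)} (h : .u ∈ A) :
    Measurable[C.sourceSigma A] fun ω => ‖C.u ω‖ := by
  simpa [sourceVal] using (C.measurable_sourceVal_sourceSigma h).ennreal_toReal

/-- The sum of the products of the magnitudes over the reflecting elements. -/
noncomputable def reflectedSum (ω : Ω) : ℝ := ∑ l, ‖C.q l ω‖ * ‖C.g l ω‖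

/-- The path gain of the HAP–RIS link. -/
noncomputable def gainQ (ω : Ω) : ℝ := pathGain S.expQ (S.heightHAP - S.heightRIS) (C.distQ ω)

/-- The path gain of the RIS–user link. -/
noncomputable def gainG (ω : Ω) : ℝ := pathGain S.expG S.heightRIS (C.distG ω)

/-- The path gain of the HAP–user link. -/
noncomputable def gainU (ω : Ω) : ℝ := pathGain S.expU S.heightHAP (C.distU ω)

/-- The magnitude of the reflected path. -/
noncomputable def reflected (ω : Ω) : ℝ := C.reflectedSum ω * (C.gainQ ω * C.gainG ω)

/-- The magnitude of the direct path. -/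
noncomputable def directPath (ω : Ω) : ℝ := ‖C.u ω‖ * C.gainU ω

/-- Both paths carry the phase arg u, so their magnitudes add without interference, also when u = 0.
-/
lemma norm_response (ω : Ω) : ‖C.response ω‖ = C.reflected ω + C.directPath ω := by
  have h : C.response ω = ((C.reflected ω + C.directPath ω : ℝ) : ℂ) *
      Complex.exp (Complex.arg (C.u ω) * Complex.I) := by
    have h1 : ∀ l, C.q l ω * C.g l ω * C.zeta l ω = ((‖C.q l ω‖ * ‖C.g l ω‖ : ℝ) : ℂ) *
        Complex.exp (Complex.arg (C.u ω) * Complex.I) := fun l => mul_mul_exp_sub_arg _ _ _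
    rw [response, Finset.sum_congr rfl fun l _ => h1 l, ← Finset.sum_mul, reflected, directPath,
      reflectedSum, gainQ, gainG, gainU]
    conv_lhs => arg 2; rw [← Complex.norm_mul_exp_arg_mul_I (C.u ω)]
    push_cast
    ring
  have h0 : 0 ≤ C.reflected ω + C.directPath ω :=
    add_nonneg (mul_nonneg (Finset.sum_nonneg fun l _ => by positivity)
      (mul_nonneg (pathGain_nonneg _ _ _) (pathGain_nonneg _ _ _)))
      (mul_nonneg (norm_nonneg _) (pathGain_nonneg _ _ _))
  rw [h, norm_mul, Complex.norm_exp_ofReal_mul_I, mul_one, Complex.norm_real,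
    Real.norm_of_nonneg h0]

lemma measurable_reflectedSum {A : Set (ChannelSource S.numRE)}
    (h : ∀ l, .q l ∈ A ∧ .g l ∈ A) : Measurable[C.sourceSigma A] C.reflectedSum :=
  Finset.measurable_fun_sum _ fun l _ =>
    (C.measurable_norm_q (h l).1).mul (C.measurable_norm_g (h l).2)

lemma measurable_gainQ {A : Set (ChannelSource S.numRE)} (h : .distQ ∈ A) :
    Measurable[C.sourceSigma A] C.gainQ :=
  (measurable_pathGain _ _).comp (C.measurable_sourceVal_sourceSigma h)

lemma measurable_gainG {A : Set (ChannelSource S.numRE)} (h : .distG ∈ A) :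
    Measurable[C.sourceSigma A] C.gainG :=
  (measurable_pathGain _ _).comp (C.measurable_sourceVal_sourceSigma h)

lemma measurable_gainU {A : Set (ChannelSource S.numRE)} (h : .distU ∈ A) :
    Measurable[C.sourceSigma A] C.gainU :=
  (measurable_pathGain _ _).comp (C.measurable_sourceVal_sourceSigma h)

/-! ### Independence of the factors of the response -/

lemma indepFun_q_g (l : Fin S.numRE) : IndepFun (fun ω => ‖C.q l ω‖) (fun ω => ‖C.g l ω‖) P :=
  C.indepFun_of_disjoint (A := {.q l}) (B := {.g l}) (by simp) (C.measurable_norm_q (by simp))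
    (C.measurable_norm_g (by simp))

lemma indepFun_mul_mul {l m : Fin S.numRE} (hlm : l ≠ m) :
    IndepFun (fun ω => ‖C.q l ω‖ * ‖C.g l ω‖) (fun ω => ‖C.q m ω‖ * ‖C.g m ω‖) P :=
  C.indepFun_of_disjoint (A := {.q l, .g l}) (B := {.q m, .g m}) (by simp [hlm.symm])
    ((C.measurable_norm_q (by simp)).mul (C.measurable_norm_g (by simp)))
    ((C.measurable_norm_q (by simp)).mul (C.measurable_norm_g (by simp)))

lemma indepFun_gainQ_gainG : IndepFun C.gainQ C.gainG P :=
  C.indepFun_of_disjoint (A := {.distQ}) (B := {.distG}) (by simp) (C.measurable_gainQ (by simp))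
    (C.measurable_gainG (by simp))

lemma indepFun_u_gainU : IndepFun (fun ω => ‖C.u ω‖) C.gainU P :=
  C.indepFun_of_disjoint (A := {.u}) (B := {.distU}) (by simp) (C.measurable_norm_u (by simp))
    (C.measurable_gainU (by simp))

lemma indepFun_reflectedSum : IndepFun C.reflectedSum (fun ω => C.gainQ ω * C.gainG ω) P :=
  C.indepFun_of_disjoint (A := {.distQ, .distG}ᶜ) (B := {.distQ, .distG}) disjoint_compl_left
    (C.measurable_reflectedSum (by simp))
    ((C.measurable_gainQ (by simp)).mul (C.measurable_gainG (by simp)))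

lemma indepFun_reflected_directPath : IndepFun C.reflected C.directPath P :=
  C.indepFun_of_disjoint (A := {.u, .distU}ᶜ) (B := {.u, .distU}) disjoint_compl_left
    ((C.measurable_reflectedSum (by simp)).mul
      ((C.measurable_gainQ (by simp)).mul (C.measurable_gainG (by simp))))
    ((C.measurable_norm_u (by simp)).mul (C.measurable_gainU (by simp)))

/-! ### First and second moments of the factors -/

lemma moments_mul (l : Fin S.numRE) : MemLp (fun ω => ‖C.q l ω‖ * ‖C.g l ω‖) 2 P ∧
    ∫ ω, ‖C.q l ω‖ * ‖C.g l ω‖ ∂P =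
      kappaMuMean S.kappaQ S.muQ * kappaMuMean S.kappaG S.muG ∧
    ∫ ω, (‖C.q l ω‖ * ‖C.g l ω‖) ^ 2 ∂P = 1 := by
  obtain ⟨a1, a2, a3⟩ := memLp_two_of_hasLaw_kappaMu S.kappaQ_nonneg S.muQ_pos (C.law_q l)
  obtain ⟨b1, b2, b3⟩ := memLp_two_of_hasLaw_kappaMu S.kappaG_nonneg S.muG_pos (C.law_g l)
  have h := C.indepFun_q_g l
  refine ⟨h.memLp_two_mul a1 b1, ?_, ?_⟩
  · rw [h.integral_fun_mul_eq_mul_integral a1.1 b1.1, a2, b2]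
  · rw [h.integral_mul_sq a1.1 b1.1, a3, b3, one_mul]

variable [IsProbabilityMeasure P]

lemma moments_gainQ : MemLp C.gainQ 2 P ∧
    ∫ ω, C.gainQ ω ∂P = S.momentHAP S.expQ (S.heightHAP - S.heightRIS) 1 ∧
    ∫ ω, C.gainQ ω ^ 2 ∂P = S.momentHAP S.expQ (S.heightHAP - S.heightRIS) 2 := by
  have hH := sub_pos.2 S.heightRIS_lt
  have h := fun t => (integral_pathGain_pow_of_hasLaw C.law_distQ t).trans
    (S.integral_pathGain_distHAPLaw S.expQ hH t)
  exact ⟨memLp_pathGain S.expQ_pos hH C.measurable_distQ, by simpa [gainQ] using h 1,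
    by simpa [gainQ] using h 2⟩

lemma _root_.HAPNetwork.heightHAP_pos (S : HAPNetwork) : 0 < S.heightHAP :=
  S.heightRIS_pos.trans S.heightRIS_lt

lemma moments_gainU : MemLp C.gainU 2 P ∧
    ∫ ω, C.gainU ω ∂P = S.momentHAP S.expU S.heightHAP 1 ∧
    ∫ ω, C.gainU ω ^ 2 ∂P = S.momentHAP S.expU S.heightHAP 2 := by
  have hH := S.heightHAP_pos
  have h := fun t => (integral_pathGain_pow_of_hasLaw C.law_distU t).trans
    (S.integral_pathGain_distHAPLaw S.expU hH t)
  exact ⟨memLp_pathGain S.expU_pos hH C.measurable_distU, by simpa [gainU] using h 1,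
    by simpa [gainU] using h 2⟩

lemma moments_gainG : MemLp C.gainG 2 P ∧ ∫ ω, C.gainG ω ∂P = S.momentRIS 1 ∧
    ∫ ω, C.gainG ω ^ 2 ∂P = S.momentRIS 2 := by
  -- Finiteness is inherited from P through the law of `distG`; the total mass need not be computed.
  have : IsFiniteMeasure S.distRISLaw := C.law_distG.isFiniteMeasure_iff.1 inferInstance
  have h := fun (t : ℕ) (ht : t ≠ 0) => (integral_pathGain_pow_of_hasLaw C.law_distG t).trans
    (S.integral_pathGain_distRISLaw ht)
  exact ⟨memLp_pathGain S.expG_pos S.heightRIS_pos C.measurable_distG,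
    by simpa [gainG] using h 1 one_ne_zero, by simpa [gainG] using h 2 two_ne_zero⟩

lemma moments_u : MemLp (fun ω => ‖C.u ω‖) 2 P ∧
    ∫ ω, ‖C.u ω‖ ∂P = (if S.direct then kappaMuMean S.kappaU S.muU else 0) ∧
    ∫ ω, ‖C.u ω‖ ^ 2 ∂P = if S.direct then 1 else 0 := by
  have h := C.law_u
  split_ifs at h ⊢
  · exact memLp_two_of_hasLaw_kappaMu S.kappaU_nonneg S.muU_pos h
  · have h0 : (fun ω => ‖C.u ω‖) =ᵐ[P] fun _ => 0 := h.ae_eq_of_dirac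
    refine ⟨(memLp_congr_ae h0).2 (memLp_const 0), ?_, ?_⟩
    · rw [integral_congr_ae h0, integral_zero]
    · refine integral_eq_zero_of_ae ?_
      filter_upwards [h0] with ω hω
      simp [hω]

lemma moments_reflectedSum : MemLp C.reflectedSum 2 P ∧
    ∫ ω, C.reflectedSum ω ∂P =
      S.numRE * (kappaMuMean S.kappaQ S.muQ * kappaMuMean S.kappaG S.muG) ∧
    ∫ ω, C.reflectedSum ω ^ 2 ∂P = ((S.numRE : ℝ) ^ 2 - S.numRE) *
      (kappaMuMean S.kappaQ S.muQ ^ 2 * kappaMuMean S.kappaG S.muG ^ 2) + S.numRE := by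
  set m := kappaMuMean S.kappaQ S.muQ * kappaMuMean S.kappaG S.muG with hm
  have hL : MemLp C.reflectedSum 2 P := memLp_finsetSum _ fun l _ => (C.moments_mul l).1
  have h1 : ∫ ω, C.reflectedSum ω ∂P = S.numRE * m := by
    simp only [reflectedSum]
    rw [integral_finsetSum _ fun l _ => (C.moments_mul l).1.integrable one_le_two,
      Finset.sum_congr rfl fun l _ => (C.moments_mul l).2.1]
    simp [hm]
  -- Variances add over the elements, each being 1 - m²; the second moment then follows by adding
  -- the squared mean.
  have h2 : Var[C.reflectedSum; P] = S.numRE * (1 - m ^ 2) := by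
    have hsum : C.reflectedSum = ∑ l, fun ω => ‖C.q l ω‖ * ‖C.g l ω‖ := by
      ext ω
      simp [reflectedSum]
    rw [hsum, IndepFun.variance_sum (fun l _ => (C.moments_mul l).1)
      fun l _ m _ hlm => C.indepFun_mul_mul hlm]
    have hv : ∀ l, Var[fun ω => ‖C.q l ω‖ * ‖C.g l ω‖; P] = 1 - m ^ 2 := fun l => by
      rw [variance_eq_sub (C.moments_mul l).1, (C.moments_mul l).2.1]
      simp only [Pi.pow_apply]
      rw [(C.moments_mul l).2.2]
    simp only [hv, Finset.sum_const, Finset.card_univ, Fintype.card_fin, nsmul_eq_mul]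
  refine ⟨hL, h1, ?_⟩
  rw [variance_eq_sub hL, h1] at h2
  simp only [Pi.pow_apply] at h2
  rw [← mul_pow, ← hm]
  linear_combination h2

lemma moments_reflected : MemLp C.reflected 2 P ∧ ∫ ω, C.reflected ω ∂P = S.meanP1 ∧
    ∫ ω, C.reflected ω ^ 2 ∂P = (((S.numRE : ℝ) ^ 2 - S.numRE) *
      (kappaMuMean S.kappaQ S.muQ ^ 2 * kappaMuMean S.kappaG S.muG ^ 2) + S.numRE) *
      S.momentHAP S.expQ (S.heightHAP - S.heightRIS) 2 * S.momentRIS 2 := by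
  obtain ⟨a1, a2, a3⟩ := C.moments_gainQ
  obtain ⟨b1, b2, b3⟩ := C.moments_gainG
  obtain ⟨c1, c2, c3⟩ := C.moments_reflectedSum
  have h1 := C.indepFun_gainQ_gainG
  have h2 := C.indepFun_reflectedSum
  have h3 := h1.memLp_two_mul a1 b1
  refine ⟨h2.memLp_two_mul c1 h3, ?_, ?_⟩
  · simp only [reflected]
    rw [h2.integral_fun_mul_eq_mul_integral c1.1 h3.1,
      h1.integral_fun_mul_eq_mul_integral a1.1 b1.1, a2, b2, c2, HAPNetwork.meanP1]
    ring
  · simp only [reflected]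
    rw [h2.integral_mul_sq c1.1 h3.1, h1.integral_mul_sq a1.1 b1.1, a3, b3, c3]
    ring

lemma moments_directPath : MemLp C.directPath 2 P ∧ ∫ ω, C.directPath ω ∂P = S.meanP2 ∧
    ∫ ω, C.directPath ω ^ 2 ∂P = if S.direct then S.momentHAP S.expU S.heightHAP 2 else 0 := by
  obtain ⟨a1, a2, a3⟩ := C.moments_gainU
  obtain ⟨b1, b2, b3⟩ := C.moments_u
  have h := C.indepFun_u_gainU
  refine ⟨h.memLp_two_mul b1 a1, ?_, ?_⟩
  · simp only [directPath]
    rw [h.integral_fun_mul_eq_mul_integral b1.1 a1.1, a2, b2, HAPNetwork.meanP2]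
    split_ifs <;> ring
  · simp only [directPath]
    rw [h.integral_mul_sq b1.1 a1.1, a3, b3]
    split_ifs <;> ring

/-! ### Positivity of mean and variance -/

lemma distRISLaw_top_lt_one : S.distRISLaw {∞} < 1 := by
  rw [S.distRISLaw_top, ENNReal.ofReal_lt_one]
  exact S.noRISProb_lt_one

lemma meanP1_pos (C : HAPChannel S P) : 0 < S.meanP1 := by
  have l : Fin S.numRE := ⟨0, S.numRE_pos⟩
  have h1 := kappaMuMean_pos_of_hasLaw S.kappaQ_nonneg S.muQ_pos (fun _ => norm_nonneg _)
    (C.law_q l)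
  have h2 := kappaMuMean_pos_of_hasLaw S.kappaG_nonneg S.muG_pos (fun _ => norm_nonneg _)
    (C.law_g l)
  have h3 : 0 < S.momentHAP S.expQ (S.heightHAP - S.heightRIS) 1 := by
    rw [← C.moments_gainQ.2.1]
    refine integral_pos_of_nonneg_of_not_ae_zero (C.moments_gainQ.1.integrable one_le_two)
      (fun ω => pathGain_nonneg _ _ _)
      (not_ae_pathGain_eq_zero _ (sub_pos.2 S.heightRIS_lt) C.law_distQ ?_)
    rw [S.distHAPLaw_top]
    exact one_pos
  have h4 : 0 < S.momentRIS 1 := by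
    rw [← C.moments_gainG.2.1]
    exact integral_pos_of_nonneg_of_not_ae_zero (C.moments_gainG.1.integrable one_le_two)
      (fun ω => pathGain_nonneg _ _ _)
      (not_ae_pathGain_eq_zero _ S.heightRIS_pos C.law_distG distRISLaw_top_lt_one)
  have h5 : (0 : ℝ) < S.numRE := by exact_mod_cast S.numRE_pos
  unfold HAPNetwork.meanP1
  positivity

/-- Zero variance would make the reflected magnitude almost surely equal to its positive mean, but
it vanishes on the event that no RIS is visible, whose probability is positive. -/
lemma variance_reflected_pos : 0 < Var[C.reflected; P] := by
  refine lt_of_le_of_ne (variance_nonneg _ _) fun h => ?_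
  have h1 := ae_eq_integral_of_variance_eq_zero C.moments_reflected.1 h.symm
  rw [C.moments_reflected.2.1] at h1
  have h2 : ∀ᵐ ω ∂P, ¬ C.distG ω = ∞ := by
    filter_upwards [h1] with ω hω htop
    have h3 := C.meanP1_pos
    rw [← hω, reflected, gainG, htop, pathGain_top] at h3
    simp at h3
  have h4 : P {ω | C.distG ω = ∞} = 0 := by simpa [ae_iff] using h2
  rw [C.law_distG.measure_eq (p := fun w => w = ∞) (measurableSet_singleton _)] at h4
  have h5 : S.distRISLaw {∞} = 0 := h4
  rw [S.distRISLaw_top, ENNReal.ofReal_eq_zero] at h5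
  exact absurd S.noRISProb_pos h5.not_gt

end HAPChannel

/-! ### Assembly of moments and capacity -/

theorem theorem2 (S : HAPNetwork) {Ω : Type*} [MeasurableSpace Ω] (P : Measure Ω)
    [IsProbabilityMeasure P] (C : HAPChannel S P) :
    MemLp (fun ω => ‖C.response ω‖) 2 P ∧
    (∫ ω, ‖C.response ω‖ ∂P) = S.meanA ∧ 0 < S.meanA ∧
    Var[fun ω => ‖C.response ω‖; P] = S.varA ∧ 0 < S.varA ∧
    IsProbabilityMeasure (snrLaw C.alpha C.beta S.rho0) ∧
    Integrable (fun x : ℝ => Real.logb 2 (1 + x)) (snrLaw C.alpha C.beta S.rho0) ∧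
    ((∀ n : ℕ, C.alpha ≠ n) →
      ergodicCapacity C.alpha C.beta S.rho0 = capacityClosedForm C.alpha C.beta S.rho0) := by
  obtain ⟨a1, a2, a3⟩ := C.moments_reflected
  obtain ⟨b1, b2, b3⟩ := C.moments_directPath
  have hfun : (fun ω => ‖C.response ω‖) = C.reflected + C.directPath :=
    funext fun ω => C.norm_response ω
  have hmean : ∫ ω, ‖C.response ω‖ ∂P = S.meanA := by
    simp only [C.norm_response]
    rw [integral_add (a1.integrable one_le_two) (b1.integrable one_le_two), a2, b2,
      HAPNetwork.meanA]
  have hP2 : 0 ≤ S.meanP2 := by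
    rw [← b2]
    exact integral_nonneg fun ω => mul_nonneg (norm_nonneg _) (pathGain_nonneg _ _ _)
  have hpos : 0 < S.meanA := add_pos_of_pos_of_nonneg C.meanP1_pos hP2
  have hadd : Var[fun ω => ‖C.response ω‖; P] = Var[C.reflected; P] + Var[C.directPath; P] := by
    rw [hfun, C.indepFun_reflected_directPath.variance_add a1 b1]
  have hvar : Var[fun ω => ‖C.response ω‖; P] = S.varA := by
    rw [hadd, variance_eq_sub a1, variance_eq_sub b1, a2, b2]
    simp only [Pi.pow_apply]
    rw [a3, b3, HAPNetwork.varA]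
  have hvpos : 0 < S.varA := by
    rw [← hvar, hadd]
    exact add_pos_of_pos_of_nonneg C.variance_reflected_pos (variance_nonneg _ _)
  have hα : 0 < C.alpha := by
    rw [HAPChannel.alpha, hmean, hvar]
    positivity
  have hβ : 0 < C.beta := by
    rw [HAPChannel.beta, hmean, hvar]
    positivity
  have hρ : 0 < S.rho0 := div_pos S.symbolEnergy_pos S.noisePower_pos
  exact ⟨hfun ▸ a1.add b1, hmean, hpos, hvar, hvpos, isProbabilityMeasure_snrLaw hα hβ hρ,
    integrable_logb_snrLaw hα hβ hρ, ergodicCapacity_eq_closedForm hα hβ hρ⟩
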